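/- Let $T$ be a plane triangulation. A planar straight-line drawing of $T$ places distinct vertices at distinct points of $\mathbb{R}^2$ and draws edges as segments so that distinct edges meet only in common vertices; it is \emph{equivalent} to $T$ if the cyclic order of the edges at each vertex and the outer face are those of $T$. A \emph{crossing-free drawing} of $T$ is a limit of a sequence of planar straight-line drawings equivalent to $T$ (so it may be degenerate). $T$ is \emph{area-universal} if for every function $\mathcal{A}$ from the set of inner faces of $T$ to $\mathbb{R}_{\ge 0}$ there is a crossing-free drawing of $T$ in which every inner face $f$ has area $\mathcal{A}(f)$. For an integer $\ell\ge 0$, the \emph{accordion graph} $A_\ell$ is the plane triangulation on $\ell+6$ vertices obtained from the plane octahedron graph as follows. Choose an edge $e$ of the central triangle (the inner face that is vertex-disjoint from the outer face), and let $u_1,u_2$ be the vertices which form with $e$ the two faces incident to $e$. Subdivide $e$ by $\ell$ new vertices $v_1,\dots,v_\ell$ and join each $v_i$ to both $u_1$ and $u_2$ by an edge drawn inside the corresponding face (for $\ell=0$ nothing changes). \textbf{Theorem.} For every integer $\ell\ge 0$, the accordion graph $A_\ell$ is area-universal if and only if $\ell$ is odd. -/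

import Mathlib

open scoped NNReal

/-- The triples `s` and `t` agree up to a cyclic rotation. -/
def CyclicEq {V : Type*} (s t : V × V × V) : Prop :=
  s = t ∨ s = (t.2.1, t.2.2, t.1) ∨ s = (t.2.2, t.1, t.2.1)

/-- The combinatorial data of a plane triangulation: the graph, its oriented facial triangles, and
the outer face. `IsFace a b c` says that `a, b, c` are, in this cyclic order, the vertices of a face
which lies to the left of `a → b → c → a` (so inner faces are listed counterclockwise, the outer
face clockwise). The faces also record the cyclic order of the edges at each vertex:
if `IsFace a b c`, then the edge `ac` is the counterclockwise successor of `ab` around `a`. -/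
structure TriangulationData (V : Type*) where
  /-- the underlying graph -/
  graph : SimpleGraph V
  /-- the facial triangles (including the outer one) -/
  IsFace : V → V → V → Prop
  /-- the outer face, with its vertices in clockwise order -/
  outer : V × V × V

/-- The two-dimensional determinant of the vectors `u` and `v`. -/
def cross (u v : ℝ × ℝ) : ℝ := u.1 * v.2 - u.2 * v.1

/-- The area of the (possibly degenerate) triangle with corners `p`, `q`, `r`. -/
noncomputable def triangleArea (p q r : ℝ × ℝ) : ℝ := |cross (q - p) (r - p)| / 2

/-- The directions of the nonzero vectors `u, v, w` are pairwise distinct and appear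
counterclockwise in this cyclic order. (Of the three counterclockwise gaps `u` to `v`, `v` to `w`,
`w` to `u`, which are positive and add up to a full turn, at least two are less than a half turn,
i.e. have positive determinant; in the opposite cyclic order, or when two of the directions agree,
at most one of the three determinants is positive.) -/
def CCWOrder (u v w : ℝ × ℝ) : Prop :=
  (0 < cross u v ∧ 0 < cross v w) ∨ (0 < cross v w ∧ 0 < cross w u) ∨
    (0 < cross w u ∧ 0 < cross u v)

namespace TriangulationData

variable {V : Type*}

/-- The faces other than the outer one; `a, b, c` is their counterclockwise order. -/
def IsInnerFace (T : TriangulationData V) (a b c : V) : Prop :=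
  T.IsFace a b c ∧ ¬ CyclicEq (a, b, c) T.outer

/-- The set of inner faces, each one given by its set of vertices. -/
def innerFaces (T : TriangulationData V) : Set (Set V) :=
  {f | ∃ a b c, T.IsInnerFace a b c ∧ f = {a, b, c}}

/-- The vertex placement `D` is a planar straight-line drawing of the graph: distinct vertices are
placed at distinct points, and distinct edges intersect at most in common vertices. -/
def IsPlanarDrawing (T : TriangulationData V) (D : V → ℝ × ℝ) : Prop :=
  Function.Injective D ∧
    ∀ a b c d, T.graph.Adj a b → T.graph.Adj c d → s(a, b) ≠ s(c, d) →
      segment ℝ (D a) (D b) ∩ segment ℝ (D c) (D d) ⊆ D '' ({a, b} ∩ {c, d})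

/-- The cyclic order of the edges around each vertex in the drawing `D` is the prescribed one:
if `ac` is the prescribed counterclockwise successor of `ab` around `a`, then in `D` no edge at `a`
lies strictly between `ab` and `ac` in counterclockwise direction. -/
def HasRotation (T : TriangulationData V) (D : V → ℝ × ℝ) : Prop :=
  ∀ a b c, T.IsFace a b c → ∀ x, T.graph.Adj a x →
    ¬ CCWOrder (D b - D a) (D x - D a) (D c - D a)

/-- The outer face of the drawing `D` is the prescribed one: the whole drawing lies in the closed
triangle spanned by the outer vertices. -/
def HasOuterFace (T : TriangulationData V) (D : V → ℝ × ℝ) : Prop :=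
  ∀ v, D v ∈ convexHull ℝ {D T.outer.1, D T.outer.2.1, D T.outer.2.2}

/-- The planar straight-line drawings that are equivalent to the plane triangulation `T`. -/
def planarDrawings (T : TriangulationData V) : Set (V → ℝ × ℝ) :=
  {D | T.IsPlanarDrawing D ∧ T.HasRotation D ∧ T.HasOuterFace D}

/-- The crossing-free (possibly degenerate) drawings equivalent to `T`: the limits of sequences of
planar straight-line drawings equivalent to `T`. -/
def crossingFreeDrawings (T : TriangulationData V) : Set (V → ℝ × ℝ) :=
  {D | ∃ E : ℕ → V → ℝ × ℝ, (∀ n, E n ∈ T.planarDrawings) ∧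
    Filter.Tendsto E Filter.atTop (nhds D)}

/-- `D` realizes the area assignment `A` on the inner faces. -/
def Realizes (T : TriangulationData V) (A : T.innerFaces → ℝ≥0) (D : V → ℝ × ℝ) : Prop :=
  ∀ (a b c : V) (h : T.IsInnerFace a b c),
    triangleArea (D a) (D b) (D c) = A ⟨{a, b, c}, a, b, c, h, rfl⟩

/-- `T` is area-universal: every assignment of nonnegative areas to the inner faces is realized by
an equivalent crossing-free drawing. -/
def IsAreaUniversal (T : TriangulationData V) : Prop :=
  ∀ A : T.innerFaces → ℝ≥0, ∃ D ∈ T.crossingFreeDrawings, T.Realizes A D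

/-- The path `p = v₀, v₁, …, vₖ, vₖ₊₁ = q` that arises when the edge `pq` is subdivided by the
`k` new vertices `v₁, …, vₖ`. -/
def subdivisionPath (p q : V) (k i : ℕ) : V ⊕ Fin k :=
  if i = 0 then Sum.inl p
  else if h : i - 1 < k then Sum.inr ⟨i - 1, h⟩
  else Sum.inl q

/-- The diamond addition of order `k` on the inner edge `pq`, where `p, q, u₁` is the face to the
left and `q, p, u₂` the face to the right of `p → q`: the edge `pq` is subdivided by `k` new
vertices, each of which is joined to `u₁` and `u₂`. The two faces at `pq` are thereby cut into
`k + 1` triangles each; all other faces are kept. -/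
def diamond (T : TriangulationData V) (p q u₁ u₂ : V) (k : ℕ) : TriangulationData (V ⊕ Fin k) where
  graph := SimpleGraph.fromRel fun x y =>
    (∃ a b, x = Sum.inl a ∧ y = Sum.inl b ∧ T.graph.Adj a b ∧ s(a, b) ≠ s(p, q)) ∨
    (∃ i ≤ k, x = subdivisionPath p q k i ∧ y = subdivisionPath p q k (i + 1)) ∨
    (∃ i : Fin k, x = Sum.inr i ∧ (y = Sum.inl u₁ ∨ y = Sum.inl u₂))
  IsFace := fun x y z =>
    (∃ a b c, x = Sum.inl a ∧ y = Sum.inl b ∧ z = Sum.inl c ∧ T.IsFace a b c ∧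
      ¬ CyclicEq (a, b, c) (p, q, u₁) ∧ ¬ CyclicEq (a, b, c) (q, p, u₂)) ∨
    (∃ i ≤ k, CyclicEq (x, y, z)
      (subdivisionPath p q k i, subdivisionPath p q k (i + 1), Sum.inl u₁)) ∨
    (∃ i ≤ k, CyclicEq (x, y, z)
      (subdivisionPath p q k (i + 1), subdivisionPath p q k i, Sum.inl u₂))
  outer := (Sum.inl T.outer.1, Sum.inl T.outer.2.1, Sum.inl T.outer.2.2)

end TriangulationData

/-- The plane octahedron graph: outer triangle `0, 1, 2` and central triangle `3, 4, 5` (both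
counterclockwise); the vertices `i` and `i + 3` are opposite, all other pairs are adjacent. -/
def octahedron : TriangulationData (Fin 6) where
  graph := SimpleGraph.fromRel fun i j => i ≠ j ∧ i + 3 ≠ j
  IsFace := fun a b c => ∃ t ∈ ([(3, 4, 5), (0, 5, 4), (1, 3, 5), (2, 4, 3),
    (0, 1, 5), (1, 2, 3), (2, 0, 4), (0, 2, 1)] : List (Fin 6 × Fin 6 × Fin 6)),
    CyclicEq (a, b, c) t
  outer := (0, 2, 1)

/-- The accordion graph of order `ℓ`: the diamond addition of order `ℓ` on the edge `34` of the
central triangle `3, 4, 5` of the plane octahedron; the two faces at this edge are `3, 4, 5` and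
`4, 3, 2`. -/
def accordion (ℓ : ℕ) : TriangulationData (Fin 6 ⊕ Fin ℓ) :=
  octahedron.diamond 3 4 5 2 ℓ

/-!
The accordion graph of order `ℓ` is a bipyramid. The vertices `2` and `5` (the south and the north
apex) are joined to every vertex of a cycle `rim 0, …, rim N`, `N = ℓ + 3`, and the outer face is
spanned by the south apex and the edge from `rim N` to `rim 0` that closes the rim.

Put the south apex at the origin, and let `P` be the north apex and `W j` the rim vertices. If `F j`
and `G j` are the areas of the triangles at the rim edge `j` with the north and the south apex, then
`t j = cross P (W j)` satisfies `t j - t (j + 1) = 2 * (F j + G j)`, so all `t j` are determined by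
one unknown. By the Grassmann–Plücker relation the fan of triangles around the south apex adds up to
`∑ 2 * G j / (t j * t (j + 1)) = 2 * S / (t 0 * t N)`, where `S` is the area of the outer triangle,
and up to an affine map a solution of this one equation determines the drawing.

*Odd `ℓ`.* Now `N` is even. After clearing denominators, the equation asks for a root of a polynomial
that has different signs at both ends of the interval of admissible values; for positive areas that
satisfy `F j * G (j + 1) ≠ F (j + 1) * G j` it does not vanish at the poles (`exists_balance`). The
root yields a drawing with positively oriented faces, in which the rim moves from left to right
between the two apexes (`exists_isRim`), and such a drawing is planar and equivalent to the
accordion graph (`IsRim.mem_planarDrawings`). Every area assignment is a limit of such generic ones,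
and since these drawings stay in a common compact box, a subsequence converges.

*Even `ℓ`.* In a planar drawing equivalent to the accordion graph all inner faces are positively
oriented (`planar_south_pos`, `planar_north_pos`, `planar_north_closing_pos`), so in a crossing-free
drawing the areas are signed areas. For the areas `F j = 1, 0, 1, …` and `G j = 0, 1, 0, …`, with
area `0` at the edge that closes the rim, the equation says that the alternating sum of the `1 / t j`
vanishes, where the `t j` form an arithmetic progression of even length. This is impossible
(`alternating_balance_ne`): the sum can be bracketed in pairs whose contributions all have the same
sign. The cases with some `t j = 0` are excluded by the Grassmann–Plücker relation.
-/

/-! ### The accordion graph as a bipyramid -/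

/-- The rim of the bipyramid: the common neighbours of the two apexes `2` and `5`, in the order
`1, 3, v₁, …, vₗ, 4, 0`. Only the indices `j ≤ ℓ + 3` are meaningful. -/
def rim (ℓ j : ℕ) : Fin 6 ⊕ Fin ℓ :=
  if j = 0 then Sum.inl 1
  else if j = ℓ + 3 then Sum.inl 0
  else TriangulationData.subdivisionPath 3 4 ℓ (j - 1)

/-- The position of a vertex on the rim; it is the junk value `0` at the two apexes. -/
def rimIndex (ℓ : ℕ) : Fin 6 ⊕ Fin ℓ → ℕ
  | Sum.inl k => if k = 0 then ℓ + 3 else if k = 3 then 1 else if k = 4 then ℓ + 2 else 0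
  | Sum.inr i => i + 2

section Combinatorics

variable {ℓ : ℕ}

lemma rim_zero : rim ℓ 0 = Sum.inl 1 := rfl

lemma rim_last : rim ℓ (ℓ + 3) = Sum.inl 0 := by simp [rim]

lemma rim_succ {i : ℕ} (hi : i ≤ ℓ + 1) :
    rim ℓ (i + 1) = TriangulationData.subdivisionPath 3 4 ℓ i := by
  have : i ≠ ℓ + 2 := by omega
  simp [rim, this]

lemma rim_one : rim ℓ 1 = Sum.inl 3 := by
  rw [rim_succ (Nat.zero_le _)]; rfl

lemma rim_inr (i : Fin ℓ) : rim ℓ (i + 2) = Sum.inr i := by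
  rw [rim_succ (by omega)]
  simp [TriangulationData.subdivisionPath]

lemma rim_four : rim ℓ (ℓ + 2) = Sum.inl 4 := by
  rw [rim_succ le_rfl]
  simp [TriangulationData.subdivisionPath]

lemma vertex_cases (v : Fin 6 ⊕ Fin ℓ) :
    v = Sum.inl 2 ∨ v = Sum.inl 5 ∨ ∃ j ≤ ℓ + 3, v = rim ℓ j := by
  rcases v with k | i
  · fin_cases k
    · exact Or.inr (Or.inr ⟨ℓ + 3, le_rfl, rim_last.symm⟩)
    · exact Or.inr (Or.inr ⟨0, by omega, rim_zero.symm⟩)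
    · exact Or.inl rfl
    · exact Or.inr (Or.inr ⟨1, by omega, rim_one.symm⟩)
    · exact Or.inr (Or.inr ⟨ℓ + 2, by omega, rim_four.symm⟩)
    · exact Or.inr (Or.inl rfl)
  · exact Or.inr (Or.inr ⟨i + 2, by omega, (rim_inr i).symm⟩)

lemma rim_cases {j : ℕ} (hj : j ≤ ℓ + 3) :
    (j = 0 ∧ rim ℓ j = Sum.inl 1) ∨ (j = 1 ∧ rim ℓ j = Sum.inl 3) ∨
      (∃ i : Fin ℓ, j = i + 2 ∧ rim ℓ j = Sum.inr i) ∨ (j = ℓ + 2 ∧ rim ℓ j = Sum.inl 4) ∨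
      (j = ℓ + 3 ∧ rim ℓ j = Sum.inl 0) := by
  by_cases h0 : j = 0
  · subst h0; exact Or.inl ⟨rfl, rim_zero⟩
  by_cases h1 : j = 1
  · subst h1; exact Or.inr (Or.inl ⟨rfl, rim_one⟩)
  by_cases h2 : j = ℓ + 2
  · subst h2; exact Or.inr (Or.inr (Or.inr (Or.inl ⟨rfl, rim_four⟩)))
  by_cases h3 : j = ℓ + 3
  · subst h3; exact Or.inr (Or.inr (Or.inr (Or.inr ⟨rfl, rim_last⟩)))
  have hi : j - 2 < ℓ := by omega
  have hj2 : j = j - 2 + 2 := by omega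
  exact Or.inr (Or.inr (Or.inl ⟨⟨j - 2, hi⟩, hj2, (congrArg (rim ℓ) hj2).trans (rim_inr ⟨j - 2, hi⟩)⟩))

lemma rimIndex_rim {j : ℕ} (hj : j ≤ ℓ + 3) : rimIndex ℓ (rim ℓ j) = j := by
  rcases rim_cases hj with ⟨h, e⟩ | ⟨h, e⟩ | ⟨i, h, e⟩ | ⟨h, e⟩ | ⟨h, e⟩ <;>
    rw [e, h] <;> simp [rimIndex]

lemma rim_injOn {i j : ℕ} (hi : i ≤ ℓ + 3) (hj : j ≤ ℓ + 3) (h : rim ℓ i = rim ℓ j) : i = j := by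
  rw [← rimIndex_rim hi, h, rimIndex_rim hj]

lemma rim_ne_south {j : ℕ} (hj : j ≤ ℓ + 3) : rim ℓ j ≠ Sum.inl 2 := by
  rcases rim_cases hj with ⟨h, e⟩ | ⟨h, e⟩ | ⟨i, h, e⟩ | ⟨h, e⟩ | ⟨h, e⟩ <;> rw [e] <;> simp

lemma rim_ne_north {j : ℕ} (hj : j ≤ ℓ + 3) : rim ℓ j ≠ Sum.inl 5 := by
  rcases rim_cases hj with ⟨h, e⟩ | ⟨h, e⟩ | ⟨i, h, e⟩ | ⟨h, e⟩ | ⟨h, e⟩ <;> rw [e] <;> simp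

/-- The edges of the bipyramid, each in one direction: from the apexes to the rim, along the rim,
and the edge that closes the rim. -/
def BipyramidEdge (ℓ : ℕ) (a b : Fin 6 ⊕ Fin ℓ) : Prop :=
  (∃ j ≤ ℓ + 3, a = Sum.inl 5 ∧ b = rim ℓ j) ∨ (∃ j ≤ ℓ + 3, a = Sum.inl 2 ∧ b = rim ℓ j) ∨
    (∃ j < ℓ + 3, a = rim ℓ j ∧ b = rim ℓ (j + 1)) ∨ (a = rim ℓ (ℓ + 3) ∧ b = rim ℓ 0)

/-- The faces of the bipyramid, each with one choice of its first vertex; the outer face is the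
last one. -/
def BipyramidFace (ℓ : ℕ) (t : (Fin 6 ⊕ Fin ℓ) × (Fin 6 ⊕ Fin ℓ) × (Fin 6 ⊕ Fin ℓ)) : Prop :=
  (∃ j < ℓ + 3, t = (Sum.inl 5, rim ℓ j, rim ℓ (j + 1))) ∨
    (∃ j < ℓ + 3, t = (Sum.inl 2, rim ℓ (j + 1), rim ℓ j)) ∨
    t = (Sum.inl 5, rim ℓ (ℓ + 3), rim ℓ 0) ∨ t = (Sum.inl 2, rim ℓ 0, rim ℓ (ℓ + 3))

lemma CyclicEq.rotate {V : Type*} {a b c : V} {t : V × V × V} (h : CyclicEq (a, b, c) t) :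
    CyclicEq (b, c, a) t := by
  rcases h with h | h | h
  · subst h; exact Or.inr (Or.inl rfl)
  · obtain ⟨rfl, rfl, rfl⟩ : a = t.2.1 ∧ b = t.2.2 ∧ c = t.1 := by simpa using h
    exact Or.inr (Or.inr rfl)
  · obtain ⟨rfl, rfl, rfl⟩ : a = t.2.2 ∧ b = t.1 ∧ c = t.2.1 := by simpa using h
    exact Or.inl rfl

lemma octahedron_face_kept {a b c : Fin 6} (h : octahedron.IsFace a b c)
    (h1 : ¬ CyclicEq (a, b, c) (3, 4, 5)) (h2 : ¬ CyclicEq (a, b, c) (4, 3, 2)) :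
    CyclicEq (a, b, c) (5, 4, 0) ∨ CyclicEq (a, b, c) (5, 1, 3) ∨ CyclicEq (a, b, c) (5, 0, 1) ∨
      CyclicEq (a, b, c) (2, 3, 1) ∨ CyclicEq (a, b, c) (2, 0, 4) ∨
      CyclicEq (a, b, c) (2, 1, 0) := by
  obtain ⟨t, ht, h⟩ := h
  simp only [List.mem_cons, List.not_mem_nil, or_false] at ht
  rcases ht with rfl | rfl | rfl | rfl | rfl | rfl | rfl | rfl <;>
    rcases h with h | h | h <;> (obtain ⟨rfl, rfl, rfl⟩ := by simpa using h) <;>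
    simp_all [CyclicEq]

lemma CyclicEq.inl {a b c a' b' c' : Fin 6} (h : CyclicEq (a, b, c) (a', b', c')) :
    CyclicEq (V := Fin 6 ⊕ Fin ℓ) (Sum.inl a, Sum.inl b, Sum.inl c)
      (Sum.inl a', Sum.inl b', Sum.inl c') := by
  simpa [CyclicEq] using h

lemma accordion_face {a b c : Fin 6 ⊕ Fin ℓ} (h : (accordion ℓ).IsFace a b c) :
    ∃ t, BipyramidFace ℓ t ∧ CyclicEq (a, b, c) t := by
  rcases h with ⟨a, b, c, rfl, rfl, rfl, h, h1, h2⟩ | ⟨i, hi, h⟩ | ⟨i, hi, h⟩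
  · rcases octahedron_face_kept h h1 h2 with h | h | h | h | h | h <;> refine ⟨_, ?_, h.inl⟩
    · exact Or.inl ⟨ℓ + 2, by omega, by rw [rim_four, rim_last]⟩
    · exact Or.inl ⟨0, by omega, by rw [rim_zero, rim_one]⟩
    · exact Or.inr (Or.inr (Or.inl (by rw [rim_zero, rim_last])))
    · exact Or.inr (Or.inl ⟨0, by omega, by rw [rim_zero, rim_one]⟩)
    · exact Or.inr (Or.inl ⟨ℓ + 2, by omega, by rw [rim_four, rim_last]⟩)
    · exact Or.inr (Or.inr (Or.inr (by rw [rim_zero, rim_last])))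
  · refine ⟨_, Or.inl ⟨i + 1, by omega, rfl⟩, ?_⟩
    rw [rim_succ (by omega), rim_succ (by omega)]
    rcases h with h | h | h <;> simp_all [CyclicEq]
  · refine ⟨_, Or.inr (Or.inl ⟨i + 1, by omega, rfl⟩), ?_⟩
    rw [rim_succ (by omega), rim_succ (by omega)]
    rcases h with h | h | h <;> simp_all [CyclicEq]

lemma face_rotate {a b c : Fin 6 ⊕ Fin ℓ} (h : (accordion ℓ).IsFace a b c) :
    (accordion ℓ).IsFace b c a := by
  rcases h with ⟨a, b, c, rfl, rfl, rfl, h, h1, h2⟩ | ⟨i, hi, h⟩ | ⟨i, hi, h⟩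
  · obtain ⟨t, ht, h⟩ := h
    exact Or.inl ⟨b, c, a, rfl, rfl, rfl, ⟨t, ht, h.rotate⟩,
      fun h' => h1 h'.rotate.rotate, fun h' => h2 h'.rotate.rotate⟩
  · exact Or.inr (Or.inl ⟨i, hi, h.rotate⟩)
  · exact Or.inr (Or.inr ⟨i, hi, h.rotate⟩)

lemma face_of_octahedron {a b c : Fin 6} (h : (a, b, c) = (5, 4, 0) ∨ (a, b, c) = (5, 1, 3) ∨
      (a, b, c) = (5, 0, 1) ∨ (a, b, c) = (2, 3, 1) ∨ (a, b, c) = (2, 0, 4) ∨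
      (a, b, c) = (2, 1, 0)) :
    (accordion ℓ).IsFace (Sum.inl a) (Sum.inl b) (Sum.inl c) := by
  refine Or.inl ⟨a, b, c, rfl, rfl, rfl, ?_⟩
  simp only [Prod.mk.injEq] at h
  rcases h with ⟨rfl, rfl, rfl⟩ | ⟨rfl, rfl, rfl⟩ | ⟨rfl, rfl, rfl⟩ | ⟨rfl, rfl, rfl⟩ |
    ⟨rfl, rfl, rfl⟩ | ⟨rfl, rfl, rfl⟩ <;> simp [octahedron, CyclicEq]

lemma face_north {j : ℕ} (hj : j < ℓ + 3) :
    (accordion ℓ).IsFace (Sum.inl 5) (rim ℓ j) (rim ℓ (j + 1)) := by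
  rcases j with _ | j
  · rw [rim_zero, rim_one]; exact face_of_octahedron (by simp)
  rcases (show j = ℓ + 1 ∨ j ≤ ℓ by omega) with rfl | hj'
  · rw [rim_four, rim_last]; exact face_of_octahedron (by simp)
  · rw [rim_succ (by omega), rim_succ (by omega)]
    exact Or.inr (Or.inl ⟨j, hj', by simp [CyclicEq]⟩)

lemma face_south {j : ℕ} (hj : j < ℓ + 3) :
    (accordion ℓ).IsFace (Sum.inl 2) (rim ℓ (j + 1)) (rim ℓ j) := by
  rcases j with _ | j
  · rw [rim_zero, rim_one]; exact face_of_octahedron (by simp)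
  rcases (show j = ℓ + 1 ∨ j ≤ ℓ by omega) with rfl | hj'
  · rw [rim_four, rim_last]; exact face_of_octahedron (by simp)
  · rw [rim_succ (by omega), rim_succ (by omega)]
    exact Or.inr (Or.inr ⟨j, hj', by simp [CyclicEq]⟩)

lemma face_north_closing :
    (accordion ℓ).IsFace (Sum.inl 5) (rim ℓ (ℓ + 3)) (rim ℓ 0) := by
  rw [rim_zero, rim_last]; exact face_of_octahedron (by simp)

lemma face_outer : (accordion ℓ).IsFace (Sum.inl 2) (rim ℓ 0) (rim ℓ (ℓ + 3)) := by
  rw [rim_zero, rim_last]; exact face_of_octahedron (by simp)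

lemma accordion_outer :
    (accordion ℓ).outer = (rim ℓ (ℓ + 3), Sum.inl 2, rim ℓ 0) := by
  rw [rim_zero, rim_last]; rfl

/-- A face that misses an outer vertex is an inner face. -/
lemma innerFace_of_face {a b c : Fin 6 ⊕ Fin ℓ} (h : (accordion ℓ).IsFace a b c)
    (hne : Sum.inl 2 ∉ ({a, b, c} : Set (Fin 6 ⊕ Fin ℓ)) ∨
      rim ℓ 0 ∉ ({a, b, c} : Set (Fin 6 ⊕ Fin ℓ)) ∨
      rim ℓ (ℓ + 3) ∉ ({a, b, c} : Set (Fin 6 ⊕ Fin ℓ))) : (accordion ℓ).IsInnerFace a b c := by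
  refine ⟨h, fun hc => ?_⟩
  rw [accordion_outer] at hc
  rcases hc with hc | hc | hc <;> simp only [Prod.mk.injEq] at hc <;>
    obtain ⟨rfl, rfl, rfl⟩ := hc <;> simp at hne

lemma innerFace_north {j : ℕ} (hj : j < ℓ + 3) :
    (accordion ℓ).IsInnerFace (Sum.inl 5) (rim ℓ j) (rim ℓ (j + 1)) := by
  refine innerFace_of_face (face_north hj) (Or.inl ?_)
  simp [(rim_ne_south (show j ≤ ℓ + 3 by omega)).symm,
    (rim_ne_south (show j + 1 ≤ ℓ + 3 by omega)).symm]

lemma innerFace_south {j : ℕ} (hj : j < ℓ + 3) :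
    (accordion ℓ).IsInnerFace (Sum.inl 2) (rim ℓ (j + 1)) (rim ℓ j) := by
  refine innerFace_of_face (face_south hj) (Or.inr ?_)
  by_contra! hc
  simp only [Set.mem_insert_iff, Set.mem_singleton_iff] at hc
  have h0 : j = 0 := by
    rcases hc.1 with h | h | h
    · exact absurd h (rim_ne_south (by omega))
    · exact absurd (rim_injOn (by omega) (by omega) h) (by omega)
    · exact (rim_injOn (by omega) (by omega) h).symm
  rcases hc.2 with h | h | h
  · exact absurd h (rim_ne_south (by omega))
  · exact absurd (rim_injOn (by omega) (by omega) h) (by omega)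
  · exact absurd (rim_injOn (by omega) (by omega) h) (by omega)

lemma innerFace_north_closing :
    (accordion ℓ).IsInnerFace (Sum.inl 5) (rim ℓ (ℓ + 3)) (rim ℓ 0) := by
  refine innerFace_of_face face_north_closing (Or.inl ?_)
  simp [(rim_ne_south (le_refl (ℓ + 3))).symm, (rim_ne_south (Nat.zero_le (ℓ + 3))).symm]

lemma octahedron_adj_iff {a b : Fin 6} : octahedron.graph.Adj a b ↔ a ≠ b ∧ a + 3 ≠ b := by
  simp only [octahedron, SimpleGraph.fromRel_adj]
  revert a b; decide

lemma accordion_adj_inl {a b : Fin 6} (hab : a ≠ b) (hab' : a + 3 ≠ b) (hne : s(a, b) ≠ s(3, 4)) :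
    (accordion ℓ).graph.Adj (Sum.inl a) (Sum.inl b) := by
  simp only [accordion, TriangulationData.diamond, SimpleGraph.fromRel_adj]
  exact ⟨by simpa using hab,
    Or.inl (Or.inl ⟨a, b, rfl, rfl, octahedron_adj_iff.2 ⟨hab, hab'⟩, hne⟩)⟩

lemma adj_north {j : ℕ} (hj : j ≤ ℓ + 3) : (accordion ℓ).graph.Adj (Sum.inl 5) (rim ℓ j) := by
  rcases rim_cases hj with ⟨h, e⟩ | ⟨h, e⟩ | ⟨i, h, e⟩ | ⟨h, e⟩ | ⟨h, e⟩ <;> rw [e]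
  · exact accordion_adj_inl (by decide) (by decide) (by decide)
  · exact accordion_adj_inl (by decide) (by decide) (by decide)
  · simp only [accordion, TriangulationData.diamond, SimpleGraph.fromRel_adj]
    exact ⟨by simp, Or.inr (Or.inr (Or.inr ⟨i, by simp⟩))⟩
  · exact accordion_adj_inl (by decide) (by decide) (by decide)
  · exact accordion_adj_inl (by decide) (by decide) (by decide)

lemma adj_south {j : ℕ} (hj : j ≤ ℓ + 3) : (accordion ℓ).graph.Adj (Sum.inl 2) (rim ℓ j) := by
  rcases rim_cases hj with ⟨h, e⟩ | ⟨h, e⟩ | ⟨i, h, e⟩ | ⟨h, e⟩ | ⟨h, e⟩ <;> rw [e]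
  · exact accordion_adj_inl (by decide) (by decide) (by decide)
  · exact accordion_adj_inl (by decide) (by decide) (by decide)
  · simp only [accordion, TriangulationData.diamond, SimpleGraph.fromRel_adj]
    exact ⟨by simp, Or.inr (Or.inr (Or.inr ⟨i, by simp⟩))⟩
  · exact accordion_adj_inl (by decide) (by decide) (by decide)
  · exact accordion_adj_inl (by decide) (by decide) (by decide)

lemma adj_rim {j : ℕ} (hj : j < ℓ + 3) : (accordion ℓ).graph.Adj (rim ℓ j) (rim ℓ (j + 1)) := by
  have hne : rim ℓ j ≠ rim ℓ (j + 1) := fun h =>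
    absurd (rim_injOn (by omega) (by omega) h) (by omega)
  rcases j with _ | j
  · rw [rim_zero, rim_one]; exact accordion_adj_inl (by decide) (by decide) (by decide)
  rcases (show j = ℓ + 1 ∨ j ≤ ℓ by omega) with rfl | hj'
  · rw [rim_four, rim_last]; exact accordion_adj_inl (by decide) (by decide) (by decide)
  · simp only [accordion, TriangulationData.diamond, SimpleGraph.fromRel_adj]
    exact ⟨hne, Or.inl (Or.inr (Or.inl ⟨j, hj', rim_succ (by omega), rim_succ (by omega)⟩))⟩

lemma adj_closing : (accordion ℓ).graph.Adj (rim ℓ (ℓ + 3)) (rim ℓ 0) := by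
  rw [rim_zero, rim_last]; exact accordion_adj_inl (by decide) (by decide) (by decide)

lemma octahedron_adj_kept {a b : Fin 6} (h : octahedron.graph.Adj a b) (hne : s(a, b) ≠ s(3, 4)) :
    BipyramidEdge ℓ (Sum.inl a) (Sum.inl b) ∨ BipyramidEdge ℓ (Sum.inl b) (Sum.inl a) := by
  have e0 : ∃ j ≤ ℓ + 3, (Sum.inl 0 : Fin 6 ⊕ Fin ℓ) = rim ℓ j := ⟨_, le_rfl, rim_last.symm⟩
  have e1 : ∃ j ≤ ℓ + 3, (Sum.inl 1 : Fin 6 ⊕ Fin ℓ) = rim ℓ j := ⟨0, by omega, rim_zero.symm⟩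
  have e3 : ∃ j ≤ ℓ + 3, (Sum.inl 3 : Fin 6 ⊕ Fin ℓ) = rim ℓ j := ⟨1, by omega, rim_one.symm⟩
  have e4 : ∃ j ≤ ℓ + 3, (Sum.inl 4 : Fin 6 ⊕ Fin ℓ) = rim ℓ j :=
    ⟨ℓ + 2, by omega, rim_four.symm⟩
  have r13 : BipyramidEdge ℓ (Sum.inl 1) (Sum.inl 3) :=
    Or.inr (Or.inr (Or.inl ⟨0, by omega, rim_zero.symm, rim_one.symm⟩))
  have r40 : BipyramidEdge ℓ (Sum.inl 4) (Sum.inl 0) :=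
    Or.inr (Or.inr (Or.inl ⟨ℓ + 2, by omega, rim_four.symm, rim_last.symm⟩))
  have r01 : BipyramidEdge ℓ (Sum.inl 0) (Sum.inl 1) :=
    Or.inr (Or.inr (Or.inr ⟨rim_last.symm, rim_zero.symm⟩))
  have n {v : Fin 6 ⊕ Fin ℓ} (hv : ∃ j ≤ ℓ + 3, v = rim ℓ j) : BipyramidEdge ℓ (Sum.inl 5) v := by
    obtain ⟨j, hj, rfl⟩ := hv
    exact Or.inl ⟨j, hj, rfl, rfl⟩
  have s {v : Fin 6 ⊕ Fin ℓ} (hv : ∃ j ≤ ℓ + 3, v = rim ℓ j) : BipyramidEdge ℓ (Sum.inl 2) v := by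
    obtain ⟨j, hj, rfl⟩ := hv
    exact Or.inr (Or.inl ⟨j, hj, rfl, rfl⟩)
  rw [octahedron_adj_iff] at h
  have := n e0; have := n e1; have := n e3; have := n e4
  have := s e0; have := s e1; have := s e3; have := s e4
  fin_cases a <;> fin_cases b <;>
    first
      | exact absurd rfl h.1
      | exact absurd rfl h.2
      | exact absurd rfl hne
      | exact absurd Sym2.eq_swap hne
      | exact Or.inl (by assumption)
      | exact Or.inr (by assumption)

lemma accordion_adj {a b : Fin 6 ⊕ Fin ℓ} (h : (accordion ℓ).graph.Adj a b) :
    BipyramidEdge ℓ a b ∨ BipyramidEdge ℓ b a := by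
  simp only [accordion, TriangulationData.diamond, SimpleGraph.fromRel_adj] at h
  have key : ∀ x y : Fin 6 ⊕ Fin ℓ,
      ((∃ a b, x = Sum.inl a ∧ y = Sum.inl b ∧ octahedron.graph.Adj a b ∧ s(a, b) ≠ s(3, 4)) ∨
      (∃ i ≤ ℓ, x = TriangulationData.subdivisionPath 3 4 ℓ i ∧
        y = TriangulationData.subdivisionPath 3 4 ℓ (i + 1)) ∨
      (∃ i : Fin ℓ, x = Sum.inr i ∧ (y = Sum.inl 5 ∨ y = Sum.inl 2))) →
      BipyramidEdge ℓ x y ∨ BipyramidEdge ℓ y x := by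
    rintro x y (⟨a, b, rfl, rfl, h, hne⟩ | ⟨i, hi, rfl, rfl⟩ | ⟨i, rfl, rfl | rfl⟩)
    · exact octahedron_adj_kept h hne
    · exact Or.inl (Or.inr (Or.inr (Or.inl ⟨i + 1, by omega, (rim_succ (by omega)).symm,
        (rim_succ (by omega)).symm⟩)))
    · exact Or.inr (Or.inl ⟨i + 2, by omega, rfl, (rim_inr i).symm⟩)
    · exact Or.inr (Or.inr (Or.inl ⟨i + 2, by omega, rfl, (rim_inr i).symm⟩))
  rcases h.2 with h | h
  · exact key _ _ h
  · exact (key _ _ h).symm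

/-- The neighbours of a rim vertex. -/
lemma adj_rim_cases {j : ℕ} (hj : j ≤ ℓ + 3) {v : Fin 6 ⊕ Fin ℓ}
    (h : (accordion ℓ).graph.Adj (rim ℓ j) v) :
    v = Sum.inl 5 ∨ v = Sum.inl 2 ∨ (j < ℓ + 3 ∧ v = rim ℓ (j + 1)) ∨
      (∃ i, j = i + 1 ∧ v = rim ℓ i) ∨ (j = ℓ + 3 ∧ v = rim ℓ 0) ∨
      (j = 0 ∧ v = rim ℓ (ℓ + 3)) := by
  rcases accordion_adj h with h | h <;>
    rcases h with ⟨i, hi, h1, h2⟩ | ⟨i, hi, h1, h2⟩ | ⟨i, hi, h1, h2⟩ | ⟨h1, h2⟩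
  · exact absurd h1 (rim_ne_north hj)
  · exact absurd h1 (rim_ne_south hj)
  · obtain rfl := rim_injOn hj (by omega) h1; exact Or.inr (Or.inr (Or.inl ⟨hi, h2⟩))
  · obtain rfl := rim_injOn hj (by omega) h1
    exact Or.inr (Or.inr (Or.inr (Or.inr (Or.inl ⟨rfl, h2⟩))))
  · exact Or.inl h1
  · exact Or.inr (Or.inl h1)
  · obtain rfl := rim_injOn hj (by omega) h2
    exact Or.inr (Or.inr (Or.inr (Or.inl ⟨i, rfl, h1⟩)))
  · obtain rfl := rim_injOn hj (by omega) h2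
    exact Or.inr (Or.inr (Or.inr (Or.inr (Or.inr ⟨rfl, h1⟩))))

lemma adj_north_cases {v : Fin 6 ⊕ Fin ℓ} (h : (accordion ℓ).graph.Adj (Sum.inl 5) v) :
    ∃ j ≤ ℓ + 3, v = rim ℓ j := by
  rcases accordion_adj h with h | h <;>
    rcases h with ⟨i, hi, h1, h2⟩ | ⟨i, hi, h1, h2⟩ | ⟨i, hi, h1, h2⟩ | ⟨h1, h2⟩
  · exact ⟨i, hi, h2⟩
  · simp at h1
  · exact absurd h1.symm (rim_ne_north (by omega))
  · exact absurd h1.symm (rim_ne_north (by omega))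
  · exact absurd h2.symm (rim_ne_north (by omega))
  · exact absurd h2.symm (rim_ne_north (by omega))
  · exact absurd h2.symm (rim_ne_north (by omega))
  · exact absurd h2.symm (rim_ne_north (by omega))

lemma adj_south_cases {v : Fin 6 ⊕ Fin ℓ} (h : (accordion ℓ).graph.Adj (Sum.inl 2) v) :
    ∃ j ≤ ℓ + 3, v = rim ℓ j := by
  rcases accordion_adj h with h | h <;>
    rcases h with ⟨i, hi, h1, h2⟩ | ⟨i, hi, h1, h2⟩ | ⟨i, hi, h1, h2⟩ | ⟨h1, h2⟩
  · simp at h1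
  · exact ⟨i, hi, h2⟩
  · exact absurd h1.symm (rim_ne_south (by omega))
  · exact absurd h1.symm (rim_ne_south (by omega))
  · exact absurd h2.symm (rim_ne_south (by omega))
  · exact absurd h2.symm (rim_ne_south (by omega))
  · exact absurd h2.symm (rim_ne_south (by omega))
  · exact absurd h2.symm (rim_ne_south (by omega))

end Combinatorics

/-! ### A normal form for planar drawings of the bipyramid -/

/-- A rim in normal position. The apexes are `(0, 0)` (south) and `(0, p)` (north), the rim vertices
`(x j, h j)`, `j ≤ N`, move strictly to the right and avoid the line through the apexes, the edge
that closes the rim is the horizontal one at height `1`, and both triangles at each rim edge are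
positively oriented. -/
structure IsRim (N : ℕ) (p : ℝ) (x h : ℕ → ℝ) : Prop where
  two_le : 2 ≤ N
  p_pos : 0 < p
  p_lt : p < 1
  h_zero : h 0 = 1
  h_last : h N = 1
  x_lt : ∀ j < N, x j < x (j + 1)
  x_ne : ∀ j ≤ N, x j ≠ 0
  x_zero_neg : x 0 < 0
  x_last_pos : 0 < x N
  south : ∀ j < N, 0 < x (j + 1) * h j - x j * h (j + 1)
  north : ∀ j < N, 0 < x j * (h (j + 1) - p) - x (j + 1) * (h j - p)

lemma lt_of_step {u : ℕ → ℝ} {i k : ℕ} (hik : i < k) (h : ∀ j, i ≤ j → j < k → u j < u (j + 1)) :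
    u i < u k := by
  induction k, hik using Nat.le_induction with
  | base => exact h i le_rfl (Nat.lt_succ_self i)
  | succ k hk ih =>
    exact (ih fun j h1 h2 => h j h1 (by omega)).trans (h k (by omega) (Nat.lt_succ_self k))

/-- The quotients `H / x` increase along consecutive counterclockwise turns within a half-plane
`x > 0` or `x < 0`, so the turns add up. -/
lemma cross_pos_of_steps {x H : ℕ → ℝ} {i k : ℕ} (hik : i < k)
    (hx : ∀ j, i ≤ j → j < k → 0 < x j * x (j + 1))
    (hs : ∀ j, i ≤ j → j < k → 0 < x j * H (j + 1) - x (j + 1) * H j) (hxx : 0 < x i * x k) :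
    0 < x i * H k - x k * H i := by
  have key : ∀ a b : ℕ, 0 < x a * x b →
      (H a / x a < H b / x b ↔ 0 < x a * H b - x b * H a) := by
    intro a b hab
    have ha : x a ≠ 0 := left_ne_zero_of_mul hab.ne'
    have hb : x b ≠ 0 := right_ne_zero_of_mul hab.ne'
    have e : H b / x b - H a / x a = (x a * H b - x b * H a) / (x a * x b) := by
      field_simp
    rw [← sub_pos, e]
    exact ⟨fun h => by simpa [ha, hb] using (mul_pos h hab), fun h => div_pos h hab⟩
  rw [← key i k hxx]
  exact lt_of_step (u := fun j => H j / x j) hik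
    fun j h1 h2 => (key j (j + 1) (hx j h1 h2)).2 (hs j h1 h2)

namespace IsRim

variable {N : ℕ} {p : ℝ} {x h : ℕ → ℝ}

lemma x_lt_x (R : IsRim N p x h) {i k : ℕ} (hik : i < k) (hk : k ≤ N) : x i < x k :=
  lt_of_step hik fun j _ h2 => R.x_lt j (by omega)

lemma x_le_x (R : IsRim N p x h) {i k : ℕ} (hik : i ≤ k) (hk : k ≤ N) : x i ≤ x k := by
  rcases hik.eq_or_lt with rfl | hik
  · rfl
  · exact (R.x_lt_x hik hk).le

lemma x_inj (R : IsRim N p x h) {i k : ℕ} (hi : i ≤ N) (hk : k ≤ N) (e : x i = x k) : i = k := by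
  rcases lt_trichotomy i k with hlt | rfl | hlt
  · exact absurd e (R.x_lt_x hlt hk).ne
  · rfl
  · exact absurd e (R.x_lt_x hlt hi).ne'

/-- Two rim vertices lie on different sides of the line through the apexes, or all the rim vertices
between them lie on the same side. -/
lemma same_side_or (R : IsRim N p x h) {i k : ℕ} (hik : i < k) (hk : k ≤ N) :
    (x i < 0 ∧ 0 < x k) ∨
      (0 < x i * x k ∧ ∀ j, i ≤ j → j < k → 0 < x j * x (j + 1)) := by
  rcases (R.x_ne i (by omega)).lt_or_gt with hi | hi
  · rcases (R.x_ne k hk).lt_or_gt with hk' | hk'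
    · refine Or.inr ⟨mul_pos_of_neg_of_neg hi hk', fun j h1 h2 => mul_pos_of_neg_of_neg ?_ ?_⟩
      · exact (R.x_le_x h2.le hk).trans_lt hk'
      · exact (R.x_le_x (show j + 1 ≤ k by omega) hk).trans_lt hk'
    · exact Or.inl ⟨hi, hk'⟩
  · refine Or.inr ⟨mul_pos hi (hi.trans (R.x_lt_x hik hk)), fun j h1 h2 => mul_pos ?_ ?_⟩
    · exact hi.trans_le (R.x_le_x h1 (by omega))
    · exact hi.trans_le (R.x_le_x (show i ≤ j + 1 by omega) (by omega))

lemma north_cross (R : IsRim N p x h) {i k : ℕ} (hik : i < k) (hk : k ≤ N) :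
    (x i < 0 ∧ 0 < x k) ∨ (0 < x i * x k ∧ 0 < x i * (h k - p) - x k * (h i - p)) := by
  rcases R.same_side_or hik hk with hs | ⟨h1, h2⟩
  · exact Or.inl hs
  · exact Or.inr ⟨h1, cross_pos_of_steps (H := fun j => h j - p) hik h2
      (fun j _ hj => R.north j (by omega)) h1⟩

lemma south_cross_same_side (R : IsRim N p x h) {i k : ℕ} (hik : i < k) (hk : k ≤ N) :
    (x i < 0 ∧ 0 < x k) ∨ (0 < x i * x k ∧ 0 < x k * h i - x i * h k) := by
  rcases R.same_side_or hik hk with hs | ⟨h1, h2⟩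
  · exact Or.inl hs
  · have := cross_pos_of_steps (H := fun j => -h j) hik h2
      (fun j _ hj => by linarith [R.south j (by omega)]) h1
    exact Or.inr ⟨h1, by linarith⟩

lemma h_pos (R : IsRim N p x h) {j : ℕ} (hj : j ≤ N) : 0 < h j := by
  have h0 := R.h_zero
  have hN := R.h_last
  have x0 := R.x_zero_neg
  have xN := R.x_last_pos
  rcases (R.x_ne j hj).lt_or_gt with hneg | hpos
  · rcases Nat.eq_zero_or_pos j with rfl | hj0
    · linarith
    rcases R.south_cross_same_side hj0 hj with ⟨-, h2⟩ | ⟨-, h2⟩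
    · linarith
    · rw [h0] at h2; by_contra! hc; nlinarith
  · rcases hj.eq_or_lt with rfl | hjN
    · linarith
    rcases R.south_cross_same_side hjN le_rfl with ⟨h2, -⟩ | ⟨-, h2⟩
    · linarith
    · rw [hN] at h2; by_contra! hc; nlinarith

/-- Seen from the south apex, the rim vertices appear in their order, from left to right. -/
lemma south_cross (R : IsRim N p x h) {i k : ℕ} (hik : i < k) (hk : k ≤ N) :
    0 < x k * h i - x i * h k := by
  have := R.h_pos hk
  have := R.h_pos (show i ≤ N by omega)
  rcases R.south_cross_same_side hik hk with ⟨h1, h2⟩ | ⟨-, h2⟩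
  · nlinarith
  · exact h2

lemma h_lt (R : IsRim N p x h) {j : ℕ} (hj0 : 0 < j) (hj : j < N) : h j < 1 := by
  have h0 := R.h_zero
  have hN := R.h_last
  have hp := R.p_lt
  rcases (R.x_ne j hj.le).lt_or_gt with hneg | hpos
  · have := R.x_lt_x hj0 hj.le
    rcases R.north_cross hj0 hj.le with ⟨-, h2⟩ | ⟨-, h2⟩
    · linarith
    · rw [h0] at h2; by_contra! hc; nlinarith
  · have := R.x_lt_x hj le_rfl
    rcases R.north_cross hj le_rfl with ⟨h2, -⟩ | ⟨-, h2⟩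
    · linarith
    · rw [hN] at h2; by_contra! hc; nlinarith

lemma h_le (R : IsRim N p x h) {j : ℕ} (hj : j ≤ N) : h j ≤ 1 := by
  rcases Nat.eq_zero_or_pos j with rfl | h0
  · exact R.h_zero.le
  rcases hj.eq_or_lt with rfl | hN
  · exact R.h_last.le
  · exact (R.h_lt h0 hN).le

lemma eq_of_h_eq_one (R : IsRim N p x h) {j : ℕ} (hj : j ≤ N) (e : h j = 1) : j = 0 ∨ j = N := by
  by_contra! hc
  exact (R.h_lt (by omega) (by omega)).ne e

/-! ### Edges of the normal form meet only in common vertices -/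

/-- An edge from an apex to the rim, against an edge of the rim; `H` measures the height above the
north apex, or the depth below the south apex. -/
lemma apex_path {x H : ℕ → ℝ}
    (hcross : ∀ i k, i < k → k ≤ N →
      (x i < 0 ∧ 0 < x k) ∨ (0 < x i * x k ∧ 0 < x i * H k - x k * H i))
    (hstep : ∀ j < N, 0 < x j * H (j + 1) - x (j + 1) * H j)
    {i j : ℕ} (hi : i ≤ N) (hj : j < N) (hxj : x j < x (j + 1)) {s u : ℝ} (hs : 0 ≤ s)
    (hu : 0 ≤ u) (hu1 : u ≤ 1) (ex : s * x i = (1 - u) * x j + u * x (j + 1))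
    (eh : s * H i = (1 - u) * H j + u * H (j + 1)) : (i = j ∧ u = 0) ∨ (i = j + 1 ∧ u = 1) := by
  have hB := hstep j hj
  have e1 : u * (x j * H (j + 1) - x (j + 1) * H j) = s * (x j * H i - x i * H j) := by
    linear_combination H j * ex - x j * eh
  have e2 : (1 - u) * (x j * H (j + 1) - x (j + 1) * H j) =
      s * (x i * H (j + 1) - x (j + 1) * H i) := by
    linear_combination x (j + 1) * eh - H (j + 1) * ex
  rcases lt_trichotomy i j with hij | rfl | hij
  · exfalso
    rcases hcross i j hij hj.le with ⟨h1, h2⟩ | ⟨-, h2⟩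
    · nlinarith
    · have : s = 0 := by
        by_contra hs0
        have : 0 < s := lt_of_le_of_ne hs (Ne.symm hs0)
        nlinarith
      subst this
      nlinarith
  · exact Or.inl ⟨rfl, by nlinarith⟩
  · rcases (show j + 1 ≤ i from hij).eq_or_lt with rfl | hij
    · exact Or.inr ⟨rfl, by nlinarith⟩
    exfalso
    rcases hcross (j + 1) i hij hi with ⟨h1, h2⟩ | ⟨-, h2⟩
    · nlinarith
    · have : s = 0 := by
        by_contra hs0
        have : 0 < s := lt_of_le_of_ne hs (Ne.symm hs0)
        nlinarith
      subst this
      nlinarith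

lemma north_path (R : IsRim N p x h) {i j : ℕ} (hi : i ≤ N) (hj : j < N) {s u : ℝ} (hs : 0 ≤ s)
    (hu : 0 ≤ u) (hu1 : u ≤ 1) (ex : s * x i = (1 - u) * x j + u * x (j + 1))
    (eh : (1 - s) * p + s * h i = (1 - u) * h j + u * h (j + 1)) :
    (i = j ∧ u = 0) ∨ (i = j + 1 ∧ u = 1) :=
  apex_path (H := fun j => h j - p) (fun _ _ => R.north_cross) R.north hi hj (R.x_lt j hj) hs hu
    hu1 ex (by linear_combination eh)

lemma south_path (R : IsRim N p x h) {i j : ℕ} (hi : i ≤ N) (hj : j < N) {s u : ℝ} (hs : 0 ≤ s)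
    (hu : 0 ≤ u) (hu1 : u ≤ 1) (ex : s * x i = (1 - u) * x j + u * x (j + 1))
    (eh : s * h i = (1 - u) * h j + u * h (j + 1)) :
    (i = j ∧ u = 0) ∨ (i = j + 1 ∧ u = 1) := by
  refine apex_path (N := N) (H := fun j => -h j) (fun i k hik hk => ?_) (fun j hj => ?_) hi hj
    (R.x_lt j hj) hs hu hu1 ex (by linear_combination -eh)
  · rcases R.south_cross_same_side hik hk with h1 | ⟨h1, h2⟩
    · exact Or.inl h1
    · exact Or.inr ⟨h1, by linarith⟩
  · linarith [R.south j hj]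

/-- Two edges at the same apex. -/
lemma apex_apex {x H : ℕ → ℝ}
    (hcross : ∀ i k, i < k → k ≤ N →
      (x i < 0 ∧ 0 < x k) ∨ (0 < x i * x k ∧ 0 < x i * H k - x k * H i))
    {i k : ℕ} (hik : i < k) (hk : k ≤ N) {s t : ℝ} (hs : 0 ≤ s) (ht : 0 ≤ t)
    (ex : s * x i = t * x k) (eh : s * H i = t * H k) : s = 0 ∧ t = 0 := by
  rcases hcross i k hik hk with ⟨h1, h2⟩ | ⟨h1, h2⟩
  · constructor <;> nlinarith
  · have e1 : s * (x i * H k - x k * H i) = 0 := by linear_combination H k * ex - x k * eh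
    have e2 : t * (x i * H k - x k * H i) = 0 := by linear_combination H i * ex - x i * eh
    exact ⟨(mul_eq_zero.1 e1).resolve_right h2.ne', (mul_eq_zero.1 e2).resolve_right h2.ne'⟩

lemma north_north (R : IsRim N p x h) {i k : ℕ} (hik : i ≠ k) (hi : i ≤ N) (hk : k ≤ N) {s t : ℝ}
    (hs : 0 ≤ s) (ht : 0 ≤ t) (ex : s * x i = t * x k)
    (eh : (1 - s) * p + s * h i = (1 - t) * p + t * h k) : s = 0 ∧ t = 0 := by
  rcases hik.lt_or_gt with hik | hik
  · exact apex_apex (H := fun j => h j - p) (fun _ _ => R.north_cross) hik hk hs ht ex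
      (by linear_combination eh)
  · exact (apex_apex (H := fun j => h j - p) (fun _ _ => R.north_cross) hik hi ht hs ex.symm
      (by linear_combination -eh)).symm

lemma south_south (R : IsRim N p x h) {i k : ℕ} (hik : i ≠ k) (hi : i ≤ N) (hk : k ≤ N) {s t : ℝ}
    (ex : s * x i = t * x k) (eh : s * h i = t * h k) : s = 0 ∧ t = 0 := by
  have key : x k * h i - x i * h k ≠ 0 := by
    rcases hik.lt_or_gt with hik | hik
    · exact (R.south_cross hik hk).ne'
    · intro e; linarith [R.south_cross hik hi]
  have e1 : s * (x k * h i - x i * h k) = 0 := by linear_combination x k * eh - h k * ex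
  have e2 : t * (x k * h i - x i * h k) = 0 := by linear_combination x i * eh - h i * ex
  exact ⟨(mul_eq_zero.1 e1).resolve_right key, (mul_eq_zero.1 e2).resolve_right key⟩

lemma north_south (R : IsRim N p x h) {i k : ℕ} (hi : i ≤ N) (hk : k ≤ N) {s t : ℝ}
    (hs : 0 ≤ s) (hs1 : s ≤ 1) (ht : 0 ≤ t) (ht1 : t ≤ 1) (ex : s * x i = t * x k)
    (eh : (1 - s) * p + s * h i = t * h k) : i = k ∧ s = 1 ∧ t = 1 := by
  have hp := R.p_pos
  have eN : t * (x k * (h i - p) - x i * (h k - p)) = -(x i * p * (1 - t)) := by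
    linear_combination (h i - p) * (-ex) + x i * eh
  have eS : s * (x k * h i - x i * h k) = -(x k * p * (1 - s)) := by
    linear_combination x k * eh - h k * ex
  have ts : s = 0 → t = 0 → False := by
    rintro rfl rfl; linarith
  rcases lt_trichotomy i k with hik | rfl | hik
  · exfalso
    have hS := R.south_cross hik hk
    rcases R.north_cross hik hk with ⟨h1, h2⟩ | ⟨h1, h2⟩
    · have : s = 0 := by nlinarith
      exact ts this (by subst this; nlinarith)
    rcases (R.x_ne i hi).lt_or_gt with hneg | hpos
    · have : 0 ≤ -(x i * p * (1 - t)) := by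
        have := mul_nonneg (mul_nonneg (neg_pos.2 hneg).le hp.le) (sub_nonneg.2 ht1); linarith
      have h3 : 0 ≤ t * (x i * (h k - p) - x k * (h i - p)) := mul_nonneg ht h2.le
      have h4 : t * (x i * (h k - p) - x k * (h i - p)) = 0 := by linarith
      have h5 : t = 0 := (mul_eq_zero.1 h4).resolve_right h2.ne'
      subst h5
      nlinarith
    · have hxk := R.x_lt_x hik hk
      have h3 : 0 ≤ s * (x k * h i - x i * h k) := mul_nonneg hs hS.le
      have h4 : 0 ≤ x k * p * (1 - s) := by
        exact mul_nonneg (mul_nonneg (by linarith) hp.le) (sub_nonneg.2 hs1)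
      have h5 : s * (x k * h i - x i * h k) = 0 := by linarith
      have h6 : s = 0 := (mul_eq_zero.1 h5).resolve_right hS.ne'
      subst h6
      nlinarith
  · have hx := R.x_ne i hi
    have hst : s = t := mul_right_cancel₀ hx ex
    subst hst
    have : s = 1 := by nlinarith
    exact ⟨rfl, this, this⟩
  · exfalso
    have hS := R.south_cross hik hi
    rcases R.north_cross hik hi with ⟨h1, h2⟩ | ⟨h1, h2⟩
    · have : s = 0 := by nlinarith
      exact ts this (by subst this; nlinarith)
    rcases (R.x_ne k hk).lt_or_gt with hneg | hpos
    · have h3 : 0 ≤ s * (x i * h k - x k * h i) := mul_nonneg hs hS.le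
      have h4 : 0 ≤ -(x k) * p * (1 - s) :=
        mul_nonneg (mul_nonneg (by linarith) hp.le) (sub_nonneg.2 hs1)
      have h5 : s * (x i * h k - x k * h i) = 0 := by linarith
      have h6 : s = 0 := (mul_eq_zero.1 h5).resolve_right hS.ne'
      subst h6
      nlinarith
    · have hxi := R.x_lt_x hik hi
      have h3 : 0 ≤ t * (x k * (h i - p) - x i * (h k - p)) := mul_nonneg ht h2.le
      have h4 : 0 ≤ x i * p * (1 - t) :=
        mul_nonneg (mul_nonneg (by linarith) hp.le) (sub_nonneg.2 ht1)
      have h5 : t * (x k * (h i - p) - x i * (h k - p)) = 0 := by linarith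
      have h6 : t = 0 := (mul_eq_zero.1 h5).resolve_right h2.ne'
      subst h6
      nlinarith

lemma path_path (R : IsRim N p x h) {i k : ℕ} (hik : i < k) (hk : k < N) {s t : ℝ}
    (hs : 0 ≤ s) (hs1 : s ≤ 1) (ht : 0 ≤ t) (ht1 : t ≤ 1)
    (ex : (1 - s) * x i + s * x (i + 1) = (1 - t) * x k + t * x (k + 1)) :
    k = i + 1 ∧ s = 1 ∧ t = 0 := by
  have h1 := R.x_lt i (by omega)
  have h2 := R.x_lt k hk
  have h3 := R.x_le_x (show i + 1 ≤ k by omega) hk.le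
  have hs' : s = 1 := by nlinarith
  have ht' : t = 0 := by nlinarith
  subst hs' ht'
  exact ⟨R.x_inj hk.le (by omega) (by linarith), rfl, rfl⟩

lemma north_closing (R : IsRim N p x h) {i : ℕ} (hi : i ≤ N) {s : ℝ} (hs : 0 ≤ s) (hs1 : s ≤ 1)
    (eh : (1 - s) * p + s * h i = 1) : (i = 0 ∨ i = N) ∧ s = 1 := by
  have h1 := R.h_le hi
  have h2 := R.p_lt
  have hs' : s = 1 := by nlinarith
  subst hs'
  exact ⟨R.eq_of_h_eq_one hi (by linarith), rfl⟩

lemma south_closing (R : IsRim N p x h) {i : ℕ} (hi : i ≤ N) {s : ℝ} (hs1 : s ≤ 1)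
    (eh : s * h i = 1) : (i = 0 ∨ i = N) ∧ s = 1 := by
  have h1 := R.h_le hi
  have h2 := R.h_pos hi
  have hs' : s = 1 := by nlinarith
  subst hs'
  exact ⟨R.eq_of_h_eq_one hi (by linarith), rfl⟩

lemma path_closing (R : IsRim N p x h) {j : ℕ} (hj : j < N) {u : ℝ} (hu : 0 ≤ u) (hu1 : u ≤ 1)
    (eh : (1 - u) * h j + u * h (j + 1) = 1) : (j = 0 ∧ u = 0) ∨ (j + 1 = N ∧ u = 1) := by
  have h2 := R.two_le
  have a1 := R.h_le hj.le
  have a2 := R.h_le (show j + 1 ≤ N from hj)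
  rcases Nat.eq_zero_or_pos j with rfl | hj0
  · have := R.h_lt (show 0 < 0 + 1 by omega) (by omega)
    exact Or.inl ⟨rfl, by nlinarith⟩
  · have := R.h_lt hj0 hj
    have hu : u = 1 := by nlinarith
    subst hu
    refine Or.inr ⟨?_, rfl⟩
    rcases R.eq_of_h_eq_one (show j + 1 ≤ N from hj) (by linarith) with h | h
    · omega
    · exact h

end IsRim

/-! ### The drawing in normal form is planar -/

lemma mem_segment_coord {a b z : ℝ × ℝ} (hz : z ∈ segment ℝ a b) :
    ∃ s : ℝ, 0 ≤ s ∧ s ≤ 1 ∧ z.1 = (1 - s) * a.1 + s * b.1 ∧ z.2 = (1 - s) * a.2 + s * b.2 := by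
  obtain ⟨r, s, hr, hs, hrs, rfl⟩ := hz
  obtain rfl : r = 1 - s := by linarith
  exact ⟨s, hs, by linarith, by simp, by simp⟩

/-- The drawing of the accordion graph with the apexes at `(0, 0)` and `(0, p)` and the rim vertices
at `(x j, h j)`. -/
noncomputable def rimDrawing (ℓ : ℕ) (p : ℝ) (x h : ℕ → ℝ) (v : Fin 6 ⊕ Fin ℓ) : ℝ × ℝ :=
  if v = Sum.inl 2 then (0, 0) else if v = Sum.inl 5 then (0, p)
  else (x (rimIndex ℓ v), h (rimIndex ℓ v))

section Drawing

variable {ℓ : ℕ} {p : ℝ} {x h : ℕ → ℝ}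

lemma rimDrawing_south : rimDrawing ℓ p x h (Sum.inl 2) = (0, 0) := by simp [rimDrawing]

lemma rimDrawing_north : rimDrawing ℓ p x h (Sum.inl 5) = (0, p) := by simp [rimDrawing]

lemma rimDrawing_rim {j : ℕ} (hj : j ≤ ℓ + 3) : rimDrawing ℓ p x h (rim ℓ j) = (x j, h j) := by
  simp [rimDrawing, rim_ne_south hj, rim_ne_north hj, rimIndex_rim hj]

namespace IsRim

lemma injective (R : IsRim (ℓ + 3) p x h) : Function.Injective (rimDrawing ℓ p x h) := by
  have hp := R.p_pos
  intro v w e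
  rcases vertex_cases v with rfl | rfl | ⟨i, hi, rfl⟩ <;>
    rcases vertex_cases w with rfl | rfl | ⟨j, hj, rfl⟩ <;>
    simp +contextual only [rimDrawing_south, rimDrawing_north, rimDrawing_rim, *,
      Prod.mk.injEq] at e
  · rfl
  · exact absurd e.2 hp.ne
  · exact absurd e.1.symm (R.x_ne j hj)
  · exact absurd e.2 hp.ne'
  · rfl
  · exact absurd e.1.symm (R.x_ne j hj)
  · exact absurd e.1 (R.x_ne i hi)
  · exact absurd e.1 (R.x_ne i hi)
  · rw [R.x_inj hi hj e.1]

lemma segments_inter (R : IsRim (ℓ + 3) p x h) {a b c d : Fin 6 ⊕ Fin ℓ}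
    (hab : BipyramidEdge ℓ a b) (hcd : BipyramidEdge ℓ c d) (hne : s(a, b) ≠ s(c, d)) :
    segment ℝ (rimDrawing ℓ p x h a) (rimDrawing ℓ p x h b) ∩
      segment ℝ (rimDrawing ℓ p x h c) (rimDrawing ℓ p x h d) ⊆
      rimDrawing ℓ p x h '' ({a, b} ∩ {c, d}) := by
  have symm : ∀ {a b c d : Fin 6 ⊕ Fin ℓ},
      segment ℝ (rimDrawing ℓ p x h a) (rimDrawing ℓ p x h b) ∩
        segment ℝ (rimDrawing ℓ p x h c) (rimDrawing ℓ p x h d) ⊆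
        rimDrawing ℓ p x h '' ({a, b} ∩ {c, d}) →
      segment ℝ (rimDrawing ℓ p x h c) (rimDrawing ℓ p x h d) ∩
        segment ℝ (rimDrawing ℓ p x h a) (rimDrawing ℓ p x h b) ⊆
        rimDrawing ℓ p x h '' ({c, d} ∩ {a, b}) := by
    intro a b c d H
    rwa [Set.inter_comm, Set.inter_comm {c, d}]
  have pathpath : ∀ i k, i < k → k < ℓ + 3 →
      segment ℝ (rimDrawing ℓ p x h (rim ℓ i)) (rimDrawing ℓ p x h (rim ℓ (i + 1))) ∩
        segment ℝ (rimDrawing ℓ p x h (rim ℓ k)) (rimDrawing ℓ p x h (rim ℓ (k + 1))) ⊆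
        rimDrawing ℓ p x h '' ({rim ℓ i, rim ℓ (i + 1)} ∩ {rim ℓ k, rim ℓ (k + 1)}) := by
    rintro i k hik hk z ⟨hz1, hz2⟩
    obtain ⟨s, hs, hs1, e1, e2⟩ := mem_segment_coord hz1
    obtain ⟨t, ht, ht1, f1, f2⟩ := mem_segment_coord hz2
    rw [rimDrawing_rim (by omega), rimDrawing_rim (by omega)] at e1 e2 f1 f2
    obtain ⟨rfl, rfl, rfl⟩ := R.path_path hik hk hs hs1 ht ht1 (by rw [← e1, f1])
    refine ⟨rim ℓ (i + 1), by simp, ?_⟩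
    rw [rimDrawing_rim (by omega)]
    ext <;> simp [e1, e2]
  have northsouth : ∀ i k, i ≤ ℓ + 3 → k ≤ ℓ + 3 →
      segment ℝ (rimDrawing ℓ p x h (Sum.inl 5)) (rimDrawing ℓ p x h (rim ℓ i)) ∩
        segment ℝ (rimDrawing ℓ p x h (Sum.inl 2)) (rimDrawing ℓ p x h (rim ℓ k)) ⊆
        rimDrawing ℓ p x h '' ({Sum.inl 5, rim ℓ i} ∩ {Sum.inl 2, rim ℓ k}) := by
    rintro i k hi hk z ⟨hz1, hz2⟩
    obtain ⟨s, hs, hs1, e1, e2⟩ := mem_segment_coord hz1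
    obtain ⟨t, ht, ht1, f1, f2⟩ := mem_segment_coord hz2
    rw [rimDrawing_rim (by omega), rimDrawing_north] at e1 e2
    rw [rimDrawing_rim (by omega), rimDrawing_south] at f1 f2
    obtain ⟨rfl, rfl, rfl⟩ := R.north_south hi hk hs hs1 ht ht1 (by linarith) (by linarith)
    refine ⟨rim ℓ i, by simp, ?_⟩
    rw [rimDrawing_rim (by omega)]
    ext <;> simp [e1, e2]
  have northpath : ∀ i k, i ≤ ℓ + 3 → k < ℓ + 3 →
      segment ℝ (rimDrawing ℓ p x h (Sum.inl 5)) (rimDrawing ℓ p x h (rim ℓ i)) ∩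
        segment ℝ (rimDrawing ℓ p x h (rim ℓ k)) (rimDrawing ℓ p x h (rim ℓ (k + 1))) ⊆
        rimDrawing ℓ p x h '' ({Sum.inl 5, rim ℓ i} ∩ {rim ℓ k, rim ℓ (k + 1)}) := by
    rintro i k hi hk z ⟨hz1, hz2⟩
    obtain ⟨s, hs, hs1, e1, e2⟩ := mem_segment_coord hz1
    obtain ⟨t, ht, ht1, f1, f2⟩ := mem_segment_coord hz2
    rw [rimDrawing_rim (by omega), rimDrawing_north] at e1 e2
    rw [rimDrawing_rim (by omega), rimDrawing_rim (by omega)] at f1 f2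
    refine ⟨rim ℓ i, ?_⟩
    rcases R.north_path hi hk hs ht ht1 (by linarith) (by linarith) with ⟨rfl, rfl⟩ | ⟨rfl, rfl⟩ <;>
    · refine ⟨by simp, ?_⟩
      rw [rimDrawing_rim (by omega)]
      ext <;> simp [f1, f2]
  have southpath : ∀ i k, i ≤ ℓ + 3 → k < ℓ + 3 →
      segment ℝ (rimDrawing ℓ p x h (Sum.inl 2)) (rimDrawing ℓ p x h (rim ℓ i)) ∩
        segment ℝ (rimDrawing ℓ p x h (rim ℓ k)) (rimDrawing ℓ p x h (rim ℓ (k + 1))) ⊆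
        rimDrawing ℓ p x h '' ({Sum.inl 2, rim ℓ i} ∩ {rim ℓ k, rim ℓ (k + 1)}) := by
    rintro i k hi hk z ⟨hz1, hz2⟩
    obtain ⟨s, hs, hs1, e1, e2⟩ := mem_segment_coord hz1
    obtain ⟨t, ht, ht1, f1, f2⟩ := mem_segment_coord hz2
    rw [rimDrawing_rim (by omega), rimDrawing_south] at e1 e2
    rw [rimDrawing_rim (by omega), rimDrawing_rim (by omega)] at f1 f2
    refine ⟨rim ℓ i, ?_⟩
    rcases R.south_path hi hk hs ht ht1 (by linarith) (by linarith) with ⟨rfl, rfl⟩ | ⟨rfl, rfl⟩ <;>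
    · refine ⟨by simp, ?_⟩
      rw [rimDrawing_rim (by omega)]
      ext <;> simp [f1, f2]
  have northclosing : ∀ i, i ≤ ℓ + 3 →
      segment ℝ (rimDrawing ℓ p x h (Sum.inl 5)) (rimDrawing ℓ p x h (rim ℓ i)) ∩
        segment ℝ (rimDrawing ℓ p x h (rim ℓ (ℓ + 3))) (rimDrawing ℓ p x h (rim ℓ 0)) ⊆
        rimDrawing ℓ p x h '' ({Sum.inl 5, rim ℓ i} ∩ {rim ℓ (ℓ + 3), rim ℓ 0}) := by
    rintro i hi z ⟨hz1, hz2⟩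
    obtain ⟨s, hs, hs1, e1, e2⟩ := mem_segment_coord hz1
    obtain ⟨t, ht, ht1, f1, f2⟩ := mem_segment_coord hz2
    rw [rimDrawing_rim (by omega), rimDrawing_north] at e1 e2
    rw [rimDrawing_rim (by omega), rimDrawing_rim (by omega), R.h_zero, R.h_last] at f2
    obtain ⟨hi', rfl⟩ := R.north_closing hi hs hs1 (by linarith)
    refine ⟨rim ℓ i, by rcases hi' with rfl | rfl <;> simp, ?_⟩
    rw [rimDrawing_rim (by omega)]
    ext <;> simp [e1, e2]
  have southclosing : ∀ i, i ≤ ℓ + 3 →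
      segment ℝ (rimDrawing ℓ p x h (Sum.inl 2)) (rimDrawing ℓ p x h (rim ℓ i)) ∩
        segment ℝ (rimDrawing ℓ p x h (rim ℓ (ℓ + 3))) (rimDrawing ℓ p x h (rim ℓ 0)) ⊆
        rimDrawing ℓ p x h '' ({Sum.inl 2, rim ℓ i} ∩ {rim ℓ (ℓ + 3), rim ℓ 0}) := by
    rintro i hi z ⟨hz1, hz2⟩
    obtain ⟨s, hs, hs1, e1, e2⟩ := mem_segment_coord hz1
    obtain ⟨t, ht, ht1, f1, f2⟩ := mem_segment_coord hz2
    rw [rimDrawing_rim (by omega), rimDrawing_south] at e1 e2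
    rw [rimDrawing_rim (by omega), rimDrawing_rim (by omega), R.h_zero, R.h_last] at f2
    obtain ⟨hi', rfl⟩ := R.south_closing hi hs1 (by linarith)
    refine ⟨rim ℓ i, by rcases hi' with rfl | rfl <;> simp, ?_⟩
    rw [rimDrawing_rim (by omega)]
    ext <;> simp [e1, e2]
  have pathclosing : ∀ i, i < ℓ + 3 →
      segment ℝ (rimDrawing ℓ p x h (rim ℓ i)) (rimDrawing ℓ p x h (rim ℓ (i + 1))) ∩
        segment ℝ (rimDrawing ℓ p x h (rim ℓ (ℓ + 3))) (rimDrawing ℓ p x h (rim ℓ 0)) ⊆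
        rimDrawing ℓ p x h '' ({rim ℓ i, rim ℓ (i + 1)} ∩ {rim ℓ (ℓ + 3), rim ℓ 0}) := by
    rintro i hi z ⟨hz1, hz2⟩
    obtain ⟨s, hs, hs1, e1, e2⟩ := mem_segment_coord hz1
    obtain ⟨t, ht, ht1, f1, f2⟩ := mem_segment_coord hz2
    rw [rimDrawing_rim (by omega), rimDrawing_rim (by omega)] at e1 e2
    rw [rimDrawing_rim (by omega), rimDrawing_rim (by omega), R.h_zero, R.h_last] at f2
    rcases R.path_closing hi hs hs1 (by linarith) with ⟨rfl, rfl⟩ | ⟨hi', rfl⟩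
    · refine ⟨rim ℓ 0, by simp, ?_⟩
      rw [rimDrawing_rim (by omega)]
      ext <;> simp [e1, e2]
    · refine ⟨rim ℓ (i + 1), by simp [hi'], ?_⟩
      rw [rimDrawing_rim (by omega)]
      ext <;> simp [e1, e2]
  rcases hab with ⟨i, hi, rfl, rfl⟩ | ⟨i, hi, rfl, rfl⟩ | ⟨i, hi, rfl, rfl⟩ | ⟨rfl, rfl⟩ <;>
    rcases hcd with ⟨k, hk, rfl, rfl⟩ | ⟨k, hk, rfl, rfl⟩ | ⟨k, hk, rfl, rfl⟩ | ⟨rfl, rfl⟩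
  · rintro z ⟨hz1, hz2⟩
    have hik : i ≠ k := by rintro rfl; exact hne rfl
    obtain ⟨s, hs, hs1, e1, e2⟩ := mem_segment_coord hz1
    obtain ⟨t, ht, ht1, f1, f2⟩ := mem_segment_coord hz2
    rw [rimDrawing_rim (by omega), rimDrawing_north] at e1 e2 f1 f2
    obtain ⟨rfl, rfl⟩ := R.north_north hik hi hk hs ht (by linarith) (by linarith)
    refine ⟨Sum.inl 5, by simp, ?_⟩
    rw [rimDrawing_north]
    ext <;> simp [e1, e2]
  · exact northsouth i k hi hk
  · exact northpath i k hi hk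
  · exact northclosing i hi
  · exact symm (northsouth k i hk hi)
  · rintro z ⟨hz1, hz2⟩
    have hik : i ≠ k := by rintro rfl; exact hne rfl
    obtain ⟨s, hs, hs1, e1, e2⟩ := mem_segment_coord hz1
    obtain ⟨t, ht, ht1, f1, f2⟩ := mem_segment_coord hz2
    rw [rimDrawing_rim (by omega), rimDrawing_south] at e1 e2 f1 f2
    obtain ⟨rfl, rfl⟩ := R.south_south (s := s) (t := t) hik hi hk (by linarith) (by linarith)
    refine ⟨Sum.inl 2, by simp, ?_⟩
    rw [rimDrawing_south]
    ext <;> simp [e1, e2]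
  · exact southpath i k hi hk
  · exact southclosing i hi
  · exact symm (northpath k i hk hi)
  · exact symm (southpath k i hk hi)
  · have hik : i ≠ k := by rintro rfl; exact hne rfl
    rcases hik.lt_or_gt with hik | hik
    · exact pathpath i k hik hk
    · exact symm (pathpath k i hik hi)
  · exact pathclosing i hi
  · exact symm (northclosing k hk)
  · exact symm (southclosing k hk)
  · exact symm (pathclosing k hk)
  · exact absurd rfl hne

lemma isPlanarDrawing (R : IsRim (ℓ + 3) p x h) :
    (accordion ℓ).IsPlanarDrawing (rimDrawing ℓ p x h) := by
  refine ⟨R.injective, fun a b c d hab hcd hne => ?_⟩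
  rcases accordion_adj hab with hab | hab <;> rcases accordion_adj hcd with hcd | hcd
  · exact R.segments_inter hab hcd hne
  · rw [segment_symm ℝ _ (rimDrawing ℓ p x h d), Set.pair_comm c d]
    exact R.segments_inter hab hcd (by rwa [Sym2.eq_swap (a := d)])
  · rw [segment_symm ℝ _ (rimDrawing ℓ p x h b), Set.pair_comm a b]
    exact R.segments_inter hab hcd (by rwa [Sym2.eq_swap (a := b)])
  · rw [segment_symm ℝ _ (rimDrawing ℓ p x h d), Set.pair_comm c d,
      segment_symm ℝ _ (rimDrawing ℓ p x h b), Set.pair_comm a b]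
    exact R.segments_inter hab hcd (by rwa [Sym2.eq_swap (a := b), Sym2.eq_swap (a := d)])

lemma hasOuterFace (R : IsRim (ℓ + 3) p x h) :
    (accordion ℓ).HasOuterFace (rimDrawing ℓ p x h) := by
  have hx0 := R.x_zero_neg
  have hxN := R.x_last_pos
  have key : ∀ X H : ℝ, H ≤ 1 → H * x 0 ≤ X → X ≤ H * x (ℓ + 3) → ((X, H) : ℝ × ℝ) ∈
      convexHull ℝ {((x (ℓ + 3), 1) : ℝ × ℝ), ((0, 0) : ℝ × ℝ), ((x 0, 1) : ℝ × ℝ)} := by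
    intro X H h1 h2 h3
    have hd : 0 < x (ℓ + 3) - x 0 := by linarith
    have hmem := (convex_convexHull ℝ
      {((x (ℓ + 3), 1) : ℝ × ℝ), ((0, 0) : ℝ × ℝ), ((x 0, 1) : ℝ × ℝ)}).sum_mem
      (t := Finset.univ)
      (w := ![(X - H * x 0) / (x (ℓ + 3) - x 0), 1 - H, (H * x (ℓ + 3) - X) / (x (ℓ + 3) - x 0)])
      (z := ![((x (ℓ + 3), 1) : ℝ × ℝ), ((0, 0) : ℝ × ℝ), ((x 0, 1) : ℝ × ℝ)])
      (fun i _ => by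
        fin_cases i
        · exact div_nonneg (by linarith) hd.le
        · exact sub_nonneg.2 h1
        · exact div_nonneg (by linarith) hd.le)
      (by simp [Fin.sum_univ_three]; field_simp; ring)
      (fun i _ => by fin_cases i <;> exact subset_convexHull ℝ _ (by simp))
    convert hmem using 1
    ext <;> simp [Fin.sum_univ_three] <;> field_simp <;> ring
  intro v
  rw [accordion_outer]
  simp only [rimDrawing_rim (le_refl (ℓ + 3)), rimDrawing_rim (Nat.zero_le (ℓ + 3)),
    rimDrawing_south, R.h_zero, R.h_last]
  rcases vertex_cases v with rfl | rfl | ⟨j, hj, rfl⟩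
  · rw [rimDrawing_south]
    exact key _ _ (by norm_num) (by simp) (by simp)
  · rw [rimDrawing_north]
    have := R.p_pos
    exact key _ _ R.p_lt.le (by nlinarith) (by nlinarith)
  · rw [rimDrawing_rim hj]
    refine key _ _ (R.h_le hj) ?_ ?_
    · rcases Nat.eq_zero_or_pos j with rfl | h0
      · rw [R.h_zero, one_mul]
      · have := R.south_cross h0 hj
        rw [R.h_zero] at this
        linarith
    · rcases hj.eq_or_lt with rfl | hN
      · rw [R.h_last, one_mul]
      · have := R.south_cross hN le_rfl
        rw [R.h_last] at this
        linarith

lemma not_ccwOrder_of_cross_nonneg {u v w : ℝ × ℝ} (h : 0 ≤ cross u w)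
    (h' : cross u v ≤ 0 ∨ cross v w ≤ 0) : ¬ CCWOrder u v w := by
  have : cross w u = -cross u w := by unfold cross; ring
  rintro (h1 | h1 | h1) <;> rcases h' with h' | h' <;> linarith [h1.1, h1.2]

lemma not_ccwOrder_of_cross_nonpos {u v w : ℝ × ℝ} (h : cross u v ≤ 0) (h' : cross v w ≤ 0) :
    ¬ CCWOrder u v w := by
  rintro (h1 | h1 | h1) <;> linarith [h1.1, h1.2]

lemma rotation_north (R : IsRim (ℓ + 3) p x h) {i j : ℕ} (hi : i ≤ ℓ + 3) (hj : j < ℓ + 3) :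
    ¬ CCWOrder ((x j, h j) - (0, p)) ((x i, h i) - (0, p)) ((x (j + 1), h (j + 1)) - (0, p)) := by
  have hN := R.north j hj
  have hx := R.x_lt j hj
  have hid : x i * (x j * (h (j + 1) - p) - x (j + 1) * (h j - p)) =
      x j * (x i * (h (j + 1) - p) - x (j + 1) * (h i - p)) +
        x (j + 1) * (x j * (h i - p) - x i * (h j - p)) := by ring
  refine not_ccwOrder_of_cross_nonneg (by simp [cross]; linarith) ?_
  simp only [cross, Prod.fst_sub, Prod.snd_sub, sub_zero]
  by_contra! hc
  rcases lt_trichotomy i j with hij | rfl | hij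
  · rcases R.north_cross hij hj.le with ⟨h1, h2⟩ | ⟨h1, h2⟩
    · nlinarith
    · linarith
  · linarith
  · rcases (show j + 1 ≤ i from hij).eq_or_lt with rfl | hij
    · linarith
    · rcases R.north_cross hij hi with ⟨h1, h2⟩ | ⟨h1, h2⟩
      · nlinarith
      · linarith

lemma rotation_north_closing (R : IsRim (ℓ + 3) p x h) {i : ℕ} (hi : i ≤ ℓ + 3) :
    ¬ CCWOrder ((x (ℓ + 3), h (ℓ + 3)) - (0, p)) ((x i, h i) - (0, p)) ((x 0, h 0) - (0, p)) := by
  have hp := R.p_lt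
  have hx0 := R.x_zero_neg
  have hxN := R.x_last_pos
  have h0 := R.h_zero
  have hN := R.h_last
  refine not_ccwOrder_of_cross_nonneg ?_ ?_
  · simp only [cross, Prod.fst_sub, Prod.snd_sub, sub_zero, h0, hN]
    nlinarith
  simp only [cross, Prod.fst_sub, Prod.snd_sub, sub_zero]
  rcases (R.x_ne i hi).lt_or_gt with hneg | hpos
  · right
    rcases Nat.eq_zero_or_pos i with rfl | hi0
    · linarith
    rcases R.north_cross hi0 hi with ⟨h1, h2⟩ | ⟨h1, h2⟩ <;> linarith
  · left
    rcases hi.eq_or_lt with rfl | hiN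
    · linarith
    rcases R.north_cross hiN le_rfl with ⟨h1, h2⟩ | ⟨h1, h2⟩ <;> linarith

lemma rotation_south (R : IsRim (ℓ + 3) p x h) {i j : ℕ} (hi : i ≤ ℓ + 3) (hj : j < ℓ + 3) :
    ¬ CCWOrder ((x (j + 1), h (j + 1)) - (0, 0)) ((x i, h i) - (0, 0)) ((x j, h j) - (0, 0)) := by
  have hS := R.south j hj
  refine not_ccwOrder_of_cross_nonneg (by simp [cross]; linarith) ?_
  simp only [cross, Prod.fst_sub, Prod.snd_sub, sub_zero]
  rcases lt_trichotomy i j with hij | rfl | hij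
  · right; linarith [R.south_cross hij hj.le]
  · right; linarith
  · left
    rcases (show j + 1 ≤ i from hij).eq_or_lt with rfl | hij
    · linarith
    · linarith [R.south_cross hij hi]

lemma rotation_south_outer (R : IsRim (ℓ + 3) p x h) {i : ℕ} (hi : i ≤ ℓ + 3) :
    ¬ CCWOrder ((x 0, h 0) - (0, 0)) ((x i, h i) - (0, 0))
      ((x (ℓ + 3), h (ℓ + 3)) - (0, 0)) := by
  refine not_ccwOrder_of_cross_nonpos ?_ ?_ <;>
    simp only [cross, Prod.fst_sub, Prod.snd_sub, sub_zero]
  · rcases Nat.eq_zero_or_pos i with rfl | h0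
    · linarith
    · linarith [R.south_cross h0 hi]
  · rcases hi.eq_or_lt with rfl | hN
    · linarith
    · linarith [R.south_cross hN le_rfl]

/-- The rotation at a rim vertex: each corner of an inner face there is less than a half turn and
every other edge is on the wrong side of one of its two edges. -/
lemma rotation_rim (R : IsRim (ℓ + 3) p x h) {b c : Fin 6 ⊕ Fin ℓ} {j : ℕ} (hj : j ≤ ℓ + 3)
    (hface : (j < ℓ + 3 ∧ b = rim ℓ (j + 1) ∧ c = Sum.inl 5) ∨
      (j < ℓ + 3 ∧ b = Sum.inl 2 ∧ c = rim ℓ (j + 1)) ∨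
      (∃ i, j = i + 1 ∧ b = Sum.inl 5 ∧ c = rim ℓ i) ∨
      (∃ i, j = i + 1 ∧ b = rim ℓ i ∧ c = Sum.inl 2) ∨
      (j = ℓ + 3 ∧ b = rim ℓ 0 ∧ c = Sum.inl 5) ∨
      (j = 0 ∧ b = Sum.inl 5 ∧ c = rim ℓ (ℓ + 3)) ∨
      (j = ℓ + 3 ∧ b = Sum.inl 2 ∧ c = rim ℓ 0) ∨
      (j = 0 ∧ b = rim ℓ (ℓ + 3) ∧ c = Sum.inl 2))
    {v : Fin 6 ⊕ Fin ℓ} (hv : (accordion ℓ).graph.Adj (rim ℓ j) v) :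
    ¬ CCWOrder (rimDrawing ℓ p x h b - rimDrawing ℓ p x h (rim ℓ j))
      (rimDrawing ℓ p x h v - rimDrawing ℓ p x h (rim ℓ j))
      (rimDrawing ℓ p x h c - rimDrawing ℓ p x h (rim ℓ j)) := by
  have hp := R.p_pos
  have hp1 := R.p_lt
  have hx0 := R.x_zero_neg
  have hxN := R.x_last_pos
  have h0 := R.h_zero
  have hN := R.h_last
  have hv := adj_rim_cases hj hv
  rw [rimDrawing_rim hj]
  rcases hface with ⟨hj', rfl, rfl⟩ | ⟨hj', rfl, rfl⟩ | ⟨k, rfl, rfl, rfl⟩ | ⟨k, rfl, rfl, rfl⟩ |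
    ⟨rfl, rfl, rfl⟩ | ⟨rfl, rfl, rfl⟩ | ⟨rfl, rfl, rfl⟩ | ⟨rfl, rfl, rfl⟩
  · have hS := R.south j hj'
    have hN := R.north j hj'
    rw [rimDrawing_rim (by omega), rimDrawing_north]
    refine not_ccwOrder_of_cross_nonneg (by simp [cross]; linarith) ?_
    rcases hv with rfl | rfl | ⟨-, rfl⟩ | ⟨i, rfl, rfl⟩ | ⟨rfl, rfl⟩ | ⟨rfl, rfl⟩
    · right; rw [rimDrawing_north]; simp [cross]; linarith
    · left; rw [rimDrawing_south]; simp [cross]; linarith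
    · left; rw [rimDrawing_rim (by omega)]; simp [cross]; linarith
    · right; rw [rimDrawing_rim (by omega)]; simp [cross]; linarith [R.north i (by omega)]
    · omega
    · right; rw [rimDrawing_rim (by omega)]; simp [cross, R.h_last, h0]; nlinarith
  · have hS := R.south j hj'
    have hN := R.north j hj'
    rw [rimDrawing_rim (by omega), rimDrawing_south]
    refine not_ccwOrder_of_cross_nonneg (by simp [cross]; linarith) ?_
    rcases hv with rfl | rfl | ⟨-, rfl⟩ | ⟨i, rfl, rfl⟩ | ⟨rfl, rfl⟩ | ⟨rfl, rfl⟩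
    · right; rw [rimDrawing_north]; simp [cross]; linarith
    · left; rw [rimDrawing_south]; simp [cross]; linarith
    · right; rw [rimDrawing_rim (by omega)]; simp [cross]; linarith
    · left; rw [rimDrawing_rim (by omega)]; simp [cross]; linarith [R.south i (by omega)]
    · omega
    · right; rw [rimDrawing_rim (by omega)]; simp [cross, R.h_last, h0]
      nlinarith [R.h_le (show 0 + 1 ≤ ℓ + 3 by omega)]
  · have hS := R.south k hj
    have hN := R.north k hj
    rw [rimDrawing_rim (by omega), rimDrawing_north]
    refine not_ccwOrder_of_cross_nonneg (by simp [cross]; linarith) ?_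
    rcases hv with rfl | rfl | ⟨hk, rfl⟩ | ⟨i, hi, rfl⟩ | ⟨hk, rfl⟩ | ⟨hk, rfl⟩
    · left; rw [rimDrawing_north]; simp [cross]; linarith
    · right; rw [rimDrawing_south]; simp [cross]; linarith
    · left; rw [rimDrawing_rim (by omega)]; simp [cross]; linarith [R.north (k + 1) hk]
    · obtain rfl : k = i := by omega
      right; rw [rimDrawing_rim (by omega)]; simp [cross]; linarith
    · left; rw [rimDrawing_rim (by omega), hk]; simp [cross, R.h_last, h0]; nlinarith
    · omega
  · have hS := R.south k hj
    have hN := R.north k hj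
    rw [rimDrawing_rim (by omega), rimDrawing_south]
    refine not_ccwOrder_of_cross_nonneg (by simp [cross]; linarith) ?_
    rcases hv with rfl | rfl | ⟨hk, rfl⟩ | ⟨i, hi, rfl⟩ | ⟨hk, rfl⟩ | ⟨hk, rfl⟩
    · left; rw [rimDrawing_north]; simp [cross]; linarith
    · right; rw [rimDrawing_south]; simp [cross]; linarith
    · right; rw [rimDrawing_rim (by omega)]; simp [cross]; linarith [R.south (k + 1) hk]
    · obtain rfl : k = i := by omega
      left; rw [rimDrawing_rim (by omega)]; simp [cross]; linarith
    · left; rw [rimDrawing_rim (by omega), hk]; simp [cross, R.h_last, h0]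
      nlinarith [R.h_le (show k ≤ ℓ + 3 by omega)]
    · omega
  · rw [rimDrawing_rim (by omega), rimDrawing_north]
    refine not_ccwOrder_of_cross_nonneg (by simp [cross, h0, hN]; nlinarith) ?_
    rcases hv with rfl | rfl | ⟨hk, rfl⟩ | ⟨i, hi, rfl⟩ | ⟨hk, rfl⟩ | ⟨hk, rfl⟩
    · right; rw [rimDrawing_north]; simp [cross]; linarith
    · right; rw [rimDrawing_south]; simp [cross, hN]; nlinarith
    · omega
    · right; rw [rimDrawing_rim (by omega), hi]; simp [cross]; linarith [R.north i (by omega)]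
    · left; rw [rimDrawing_rim (by omega)]; simp [cross]; linarith
    · omega
  · rw [rimDrawing_rim (by omega), rimDrawing_north]
    refine not_ccwOrder_of_cross_nonneg (by simp [cross, h0, hN]; nlinarith) ?_
    rcases hv with rfl | rfl | ⟨hk, rfl⟩ | ⟨i, hi, rfl⟩ | ⟨hk, rfl⟩ | ⟨hk, rfl⟩
    · left; rw [rimDrawing_north]; simp [cross]; linarith
    · left; rw [rimDrawing_south]; simp [cross, h0]; nlinarith
    · left; rw [rimDrawing_rim (by omega)]; simp [cross]; linarith [R.north 0 (by omega)]
    · omega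
    · omega
    · right; rw [rimDrawing_rim (by omega)]; simp [cross]; linarith
  · rw [rimDrawing_rim (by omega), rimDrawing_south]
    have key : ∀ X H : ℝ, H ≤ 1 → X ≤ H * x (ℓ + 3) →
        ¬ CCWOrder ((0, 0) - (x (ℓ + 3), h (ℓ + 3))) ((X, H) - (x (ℓ + 3), h (ℓ + 3)))
          ((x 0, h 0) - (x (ℓ + 3), h (ℓ + 3))) := by
      intro X H h1 h2
      refine not_ccwOrder_of_cross_nonpos ?_ ?_ <;> simp [cross, h0, hN] <;> nlinarith
    rcases hv with rfl | rfl | ⟨hk, rfl⟩ | ⟨i, hi, rfl⟩ | ⟨hk, rfl⟩ | ⟨hk, rfl⟩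
    · rw [rimDrawing_north]; exact key _ _ hp1.le (by nlinarith)
    · rw [rimDrawing_south]; exact key _ _ (by norm_num) (by simp)
    · omega
    · rw [rimDrawing_rim (by omega)]
      have := R.south_cross (show i < ℓ + 3 by omega) le_rfl
      rw [hN] at this
      exact key _ _ (R.h_le (by omega)) (by linarith)
    · rw [rimDrawing_rim (by omega)]
      exact key _ _ (R.h_le (by omega)) (by rw [h0]; linarith)
    · omega
  · rw [rimDrawing_rim (by omega), rimDrawing_south]
    have key : ∀ X H : ℝ, H ≤ 1 → H * x 0 ≤ X →
        ¬ CCWOrder ((x (ℓ + 3), h (ℓ + 3)) - (x 0, h 0)) ((X, H) - (x 0, h 0))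
          ((0, 0) - (x 0, h 0)) := by
      intro X H h1 h2
      refine not_ccwOrder_of_cross_nonpos ?_ ?_ <;> simp [cross, h0, hN] <;> nlinarith
    rcases hv with rfl | rfl | ⟨hk, rfl⟩ | ⟨i, hi, rfl⟩ | ⟨hk, rfl⟩ | ⟨hk, rfl⟩
    · rw [rimDrawing_north]; exact key _ _ hp1.le (by nlinarith)
    · rw [rimDrawing_south]; exact key _ _ (by norm_num) (by simp)
    · rw [rimDrawing_rim (by omega)]
      have := R.south_cross (show 0 < 0 + 1 by omega) (by omega)
      rw [h0] at this
      exact key _ _ (R.h_le (by omega)) (by linarith)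
    · omega
    · omega
    · rw [rimDrawing_rim (by omega)]
      exact key _ _ (R.h_le (by omega)) (by rw [hN]; linarith)

lemma hasRotation (R : IsRim (ℓ + 3) p x h) :
    (accordion ℓ).HasRotation (rimDrawing ℓ p x h) := by
  intro a b c hface v hv
  obtain ⟨t, ht, hc⟩ := accordion_face hface
  rcases ht with ⟨j, hj, rfl⟩ | ⟨j, hj, rfl⟩ | rfl | rfl <;> rcases hc with hc | hc | hc <;>
    simp only [Prod.mk.injEq] at hc <;> obtain ⟨rfl, rfl, rfl⟩ := hc
  · obtain ⟨i, hi, rfl⟩ := adj_north_cases hv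
    rw [rimDrawing_north, rimDrawing_rim (by omega), rimDrawing_rim (by omega),
      rimDrawing_rim (by omega)]
    exact R.rotation_north hi hj
  · exact R.rotation_rim hj.le (Or.inl ⟨hj, rfl, rfl⟩) hv
  · exact R.rotation_rim hj (Or.inr (Or.inr (Or.inl ⟨j, rfl, rfl, rfl⟩))) hv
  · obtain ⟨i, hi, rfl⟩ := adj_south_cases hv
    rw [rimDrawing_south, rimDrawing_rim (by omega), rimDrawing_rim (by omega),
      rimDrawing_rim (by omega)]
    exact R.rotation_south hi hj
  · exact R.rotation_rim hj (Or.inr (Or.inr (Or.inr (Or.inl ⟨j, rfl, rfl, rfl⟩)))) hv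
  · exact R.rotation_rim hj.le (Or.inr (Or.inl ⟨hj, rfl, rfl⟩)) hv
  · obtain ⟨i, hi, rfl⟩ := adj_north_cases hv
    rw [rimDrawing_north, rimDrawing_rim (by omega), rimDrawing_rim (by omega),
      rimDrawing_rim (by omega)]
    exact R.rotation_north_closing hi
  · exact R.rotation_rim le_rfl (by simp) hv
  · exact R.rotation_rim (Nat.zero_le _) (by simp) hv
  · obtain ⟨i, hi, rfl⟩ := adj_south_cases hv
    rw [rimDrawing_south, rimDrawing_rim (by omega), rimDrawing_rim (by omega),
      rimDrawing_rim (by omega)]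
    exact R.rotation_south_outer hi
  · exact R.rotation_rim (Nat.zero_le _) (by simp) hv
  · exact R.rotation_rim le_rfl (by simp) hv

theorem mem_planarDrawings (R : IsRim (ℓ + 3) p x h) :
    rimDrawing ℓ p x h ∈ (accordion ℓ).planarDrawings :=
  ⟨R.isPlanarDrawing, R.hasRotation, R.hasOuterFace⟩

end IsRim

end Drawing

/-! ### Rims with prescribed areas -/

/-- The sum of `G j / ((y - τ j) * (y - τ (j + 1)))` over `j < n`, multiplied by the product of all
`y - τ i`, `i ≤ n`, as a polynomial in `y`. -/
def clearedSum (τ G : ℕ → ℝ) (y : ℝ) : ℕ → ℝ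
  | 0 => 0
  | n + 1 => (y - τ (n + 1)) * clearedSum τ G y n + G n * ∏ i ∈ Finset.range n, (y - τ i)

lemma continuous_clearedSum (τ G : ℕ → ℝ) (n : ℕ) : Continuous fun y => clearedSum τ G y n := by
  induction n with
  | zero => exact continuous_const
  | succ n ih => simp only [clearedSum]; fun_prop

lemma clearedSum_eq {τ G : ℕ → ℝ} {y : ℝ} {n : ℕ} (hy : ∀ j ≤ n, y ≠ τ j) :
    clearedSum τ G y n = (∏ i ∈ Finset.range (n + 1), (y - τ i)) *
      ∑ j ∈ Finset.range n, G j / ((y - τ j) * (y - τ (j + 1))) := by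
  induction n with
  | zero => simp [clearedSum]
  | succ n ih =>
    have h1 : y - τ n ≠ 0 := sub_ne_zero.2 (hy n (by omega))
    have h2 : y - τ (n + 1) ≠ 0 := sub_ne_zero.2 (hy (n + 1) le_rfl)
    rw [clearedSum, ih fun j hj => hy j (by omega), Finset.sum_range_succ,
      Finset.prod_range_succ _ (n + 1), Finset.prod_range_succ _ n]
    field_simp

/-- At an interior pole only the two adjacent summands survive. -/
lemma clearedSum_ne_zero {τ G : ℕ → ℝ} {k n : ℕ} (hkn : k + 2 ≤ n)
    (hτ : ∀ j ≤ n, j ≠ k + 1 → τ (k + 1) ≠ τ j)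
    (hG : G k * (τ (k + 1) - τ (k + 2)) + G (k + 1) * (τ (k + 1) - τ k) ≠ 0) :
    clearedSum τ G (τ (k + 1)) n ≠ 0 := by
  induction n, hkn using Nat.le_induction with
  | base =>
    have e : clearedSum τ G (τ (k + 1)) (k + 2) = (∏ i ∈ Finset.range k, (τ (k + 1) - τ i)) *
        (G k * (τ (k + 1) - τ (k + 2)) + G (k + 1) * (τ (k + 1) - τ k)) := by
      simp only [clearedSum, Finset.prod_range_succ]
      ring
    rw [e]
    refine mul_ne_zero (Finset.prod_ne_zero_iff.2 fun i hi => ?_) hG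
    rw [Finset.mem_range] at hi
    exact sub_ne_zero.2 (hτ i (by omega) (by omega))
  | succ n hn ih =>
    have e : ∏ i ∈ Finset.range n, (τ (k + 1) - τ i) = 0 :=
      Finset.prod_eq_zero (i := k + 1) (Finset.mem_range.2 (by omega)) (sub_self _)
    rw [clearedSum, e, mul_zero, add_zero]
    exact mul_ne_zero (sub_ne_zero.2 (hτ (n + 1) le_rfl (by omega)))
      (ih fun j hj hne => hτ j (by omega) hne)

lemma clearedSum_at_zero {τ G : ℕ → ℝ} (h0 : τ 0 = 0) (n : ℕ) :
    clearedSum τ G 0 (n + 1) * -τ 1 = G 0 * ∏ i ∈ Finset.range (n + 1), (0 - τ (i + 1)) := by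
  induction n with
  | zero => simp [clearedSum]
  | succ n ih =>
    have e : ∏ i ∈ Finset.range (n + 1), (0 - τ i) = 0 :=
      Finset.prod_eq_zero (i := 0) (by simp) (by simp [h0])
    rw [clearedSum, e, Finset.prod_range_succ, ← mul_assoc, ← ih]
    ring

lemma prod_neg_of_odd {u : ℕ → ℝ} {n : ℕ} (hn : Odd n) (hu : ∀ i < n, 0 < u i) :
    ∏ i ∈ Finset.range n, (0 - u i) < 0 := by
  have e : ∏ i ∈ Finset.range n, (0 - u i) = -∏ i ∈ Finset.range n, u i := by
    simp only [zero_sub]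
    rw [Finset.prod_neg, Finset.card_range, hn.neg_one_pow]
    ring
  rw [e, neg_neg_iff_pos]
  exact Finset.prod_pos fun i hi => hu i (Finset.mem_range.1 hi)

/-- Solution of the equation that decides whether the fans around the two apexes of the bipyramid
close up. After multiplication by the denominators, the difference of both sides is a polynomial
that changes its sign between `0` and `τ N` when `N` is even, and that does not vanish at the
poles. -/
lemma exists_balance {N : ℕ} (hN : Even N) (h2 : 2 ≤ N) {G τ : ℕ → ℝ} {S : ℝ} (h0 : τ 0 = 0)
    (hG : ∀ j < N, 0 < G j) (hτ : ∀ j < N, G j < τ (j + 1) - τ j) (hS : τ N < S)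
    (hgen : ∀ j, j + 1 < N →
      G j * (τ (j + 1) - τ (j + 2)) + G (j + 1) * (τ (j + 1) - τ j) ≠ 0) :
    ∃ y, 0 < y ∧ y < τ N ∧ (∀ j ≤ N, τ j ≠ y) ∧
      ∑ j ∈ Finset.range N, G j / ((τ j - y) * (τ (j + 1) - y)) =
        S / ((τ 0 - y) * (τ N - y)) := by
  have hmono : ∀ i k, i < k → k ≤ N → τ i < τ k := fun i k hik hk =>
    lt_of_step hik fun j _ h2 => by linarith [hG j (by omega), hτ j (by omega)]
  have hpos : ∀ k, 0 < k → k ≤ N → 0 < τ k := fun k hk hkN => by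
    have := hmono 0 k hk hkN; rwa [h0] at this
  have hinj : ∀ i k, i ≤ N → k ≤ N → i ≠ k → τ i ≠ τ k := by
    intro i k hi hk hik
    rcases hik.lt_or_gt with h | h
    · exact (hmono i k h hk).ne
    · exact (hmono k i h hi).ne'
  obtain ⟨n, rfl⟩ : ∃ n, N = n + 1 := ⟨N - 1, by omega⟩
  have hn : Odd n := by
    rcases Nat.even_or_odd n with h | h
    · exact absurd hN (Nat.not_even_iff_odd.2 h.add_one)
    · exact h
  set V : ℝ → ℝ := fun y => ∏ i ∈ Finset.range n, (y - τ (i + 1)) with hV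
  set f : ℝ → ℝ := fun y => S * V y - clearedSum τ G y (n + 1) with hf
  have hfc : Continuous f := by
    have := continuous_clearedSum τ G (n + 1)
    simp only [hf, hV]
    fun_prop
  have hM := hpos (n + 1) (by omega) le_rfl
  have f0 : f 0 < 0 := by
    have hK : V 0 < 0 := prod_neg_of_odd hn fun i hi => hpos (i + 1) (by omega) (by omega)
    have h1 := clearedSum_at_zero (G := G) h0 n
    rw [Finset.prod_range_succ] at h1
    have hτ1 := hpos 1 (by omega) (by omega)
    have e : f 0 * τ 1 = V 0 * (S * τ 1 - G 0 * τ (n + 1)) := by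
      simp only [hf]
      linear_combination h1
    have hlt : 0 < S * τ 1 - G 0 * τ (n + 1) := by
      have h3 := hτ 0 (by omega)
      have h4 := hG 0 (by omega)
      rw [h0] at h3
      nlinarith
    have := mul_neg_of_neg_of_pos hK hlt
    rw [← e] at this
    exact neg_of_mul_neg_left this hτ1.le
  have fM : 0 < f (τ (n + 1)) := by
    have hVpos : 0 < V (τ (n + 1)) := Finset.prod_pos fun i hi => by
      rw [Finset.mem_range] at hi
      exact sub_pos.2 (hmono _ _ (by omega) le_rfl)
    have e1 : (∏ i ∈ Finset.range n, (τ (n + 1) - τ i)) * (τ (n + 1) - τ n) =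
        V (τ (n + 1)) * τ (n + 1) := by
      rw [← Finset.prod_range_succ, Finset.prod_range_succ', h0, sub_zero]
    have h3 := hτ n (by omega)
    have h4 := hG n (by omega)
    have e : f (τ (n + 1)) * (τ (n + 1) - τ n) =
        V (τ (n + 1)) * (S * (τ (n + 1) - τ n) - G n * τ (n + 1)) := by
      simp only [hf, clearedSum, sub_self, zero_mul, zero_add]
      linear_combination -G n * e1
    have hlt : 0 < S * (τ (n + 1) - τ n) - G n * τ (n + 1) := by nlinarith
    have := mul_pos hVpos hlt
    rw [← e] at this
    exact pos_of_mul_pos_left this (by linarith)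
  obtain ⟨y, ⟨hy0, hyM⟩, hfy⟩ := intermediate_value_Icc hM.le hfc.continuousOn
    (Set.mem_Icc.2 ⟨f0.le, fM.le⟩)
  have hyne : ∀ j ≤ n + 1, τ j ≠ y := by
    rintro j hj rfl
    rcases Nat.eq_zero_or_pos j with rfl | hj0
    · rw [h0] at hfy; exact f0.ne hfy
    rcases hj.eq_or_lt with rfl | hjN
    · exact fM.ne' hfy
    obtain ⟨k, rfl⟩ : ∃ k, j = k + 1 := ⟨j - 1, by omega⟩
    have e : V (τ (k + 1)) = 0 :=
      Finset.prod_eq_zero (i := k) (Finset.mem_range.2 (by omega)) (sub_self _)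
    refine clearedSum_ne_zero (show k + 2 ≤ n + 1 by omega)
      (fun i hi hne => hinj _ _ hj hi (Ne.symm hne)) (hgen k (by omega)) ?_
    simp only [hf, e, mul_zero, zero_sub, neg_eq_zero] at hfy
    exact hfy
  refine ⟨y, lt_of_le_of_ne hy0 ?_, lt_of_le_of_ne hyM (hyne _ le_rfl).symm, hyne, ?_⟩
  · rw [← h0]; exact hyne 0 (by omega)
  have hys : ∀ j ≤ n + 1, y - τ j ≠ 0 := fun j hj => sub_ne_zero.2 (hyne j hj).symm
  have hVy : V y ≠ 0 := Finset.prod_ne_zero_iff.2 fun i hi => by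
    rw [Finset.mem_range] at hi
    exact hys _ (by omega)
  have hcs := clearedSum_eq (G := G) fun j hj => (hyne j hj).symm
  rw [Finset.prod_range_succ, Finset.prod_range_succ'] at hcs
  have hfy' : S * V y = clearedSum τ G y (n + 1) := sub_eq_zero.1 hfy
  rw [hcs] at hfy'
  have e : ∀ j k, (τ j - y) * (τ k - y) = (y - τ j) * (y - τ k) := fun j k => by ring
  simp only [e]
  rw [eq_div_iff (mul_ne_zero (hys 0 (by omega)) (hys _ le_rfl))]
  apply mul_left_cancel₀ hVy
  linear_combination -hfy'

/-- For generic positive areas and an even number of rim edges there is a rim in normal position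
whose triangles have these areas: `G j` at the south apex, `F j` at the north apex, and `a` between
the north apex and the edge that closes the rim. -/
lemma exists_isRim {N : ℕ} (hN : Even N) (h2 : 2 ≤ N) {F G : ℕ → ℝ} {a : ℝ} (ha : 0 < a)
    (hF : ∀ j < N, 0 < F j) (hG : ∀ j < N, 0 < G j)
    (hgen : ∀ j, j + 1 < N → F j * G (j + 1) ≠ F (j + 1) * G j) :
    ∃ p x h, IsRim N p x h ∧ (∀ j < N, x (j + 1) * h j - x j * h (j + 1) = 2 * G j) ∧
      (∀ j < N, x j * (h (j + 1) - p) - x (j + 1) * (h j - p) = 2 * F j) ∧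
      (x N - x 0) * (1 - p) = 2 * a ∧
      x N - x 0 = 2 * (a + ∑ j ∈ Finset.range N, (F j + G j)) := by
  set τ : ℕ → ℝ := fun j => ∑ i ∈ Finset.range j, (F i + G i) with hτ
  have hstep : ∀ j, τ (j + 1) - τ j = F j + G j := fun j => by
    simp only [hτ, Finset.sum_range_succ]; ring
  have h0 : τ 0 = 0 := by simp [hτ]
  have hM : 0 < τ N := by
    refine Finset.sum_pos (fun i hi => ?_) ⟨0, Finset.mem_range.2 (by omega)⟩
    rw [Finset.mem_range] at hi
    exact add_pos (hF i hi) (hG i hi)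
  obtain ⟨y, hy0, hyM, hyne, hsum⟩ := exists_balance hN h2 (S := a + τ N) h0 hG
    (fun j hj => by rw [hstep]; linarith [hF j hj]) (by linarith) (by
      intro j hj e
      apply hgen j hj
      have h3 : τ (j + 1) - τ (j + 2) = -(F (j + 1) + G (j + 1)) := by
        linarith [hstep (j + 1)]
      rw [hstep, h3] at e
      linarith)
  set S := a + τ N with hS
  have hSpos : 0 < S := by linarith
  -- the factor that makes the outer triangle, of height `1`, have area `S`
  set r := 2 * S / τ N with hr
  have hrpos : 0 < r := by positivity
  have hrM : r * τ N = 2 * S := by rw [hr]; field_simp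
  set x : ℕ → ℝ := fun j => r * (τ j - y) with hx
  have hxne : ∀ j ≤ N, x j ≠ 0 := fun j hj => mul_ne_zero hrpos.ne' (sub_ne_zero.2 (hyne j hj))
  set m : ℕ → ℝ := fun j => 1 / x 0 - ∑ i ∈ Finset.range j, 2 * G i / (x i * x (i + 1)) with hm
  have hmstep : ∀ j, m j - m (j + 1) = 2 * G j / (x j * x (j + 1)) := fun j => by
    simp only [hm, Finset.sum_range_succ]; ring
  have hx0N : x N - x 0 = 2 * S := by
    simp only [hx, h0]; linarith
  have hxN := hxne N le_rfl
  have hx0 := hxne 0 (by omega)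
  have hmN : x N * m N = 1 := by
    have e : ∑ i ∈ Finset.range N, 2 * G i / (x i * x (i + 1)) = 1 / x 0 - 1 / x N := by
      have e1 : ∑ i ∈ Finset.range N, 2 * G i / (x i * x (i + 1)) =
          2 / (r * r) * ∑ j ∈ Finset.range N, G j / ((τ j - y) * (τ (j + 1) - y)) := by
        rw [Finset.mul_sum]
        refine Finset.sum_congr rfl fun i hi => ?_
        rw [div_mul_div_comm]
        congr 1
        simp only [hx]; ring
      rw [e1, hsum, div_mul_div_comm, div_sub_div _ _ hx0 hxN]
      congr 1
      · linarith
      · simp only [hx]; ring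
    simp only [hm, e]
    field_simp
    ring
  have hA : ∀ j < N, x (j + 1) * (x j * m j) - x j * (x (j + 1) * m (j + 1)) = 2 * G j := by
    intro j hj
    have e1 := hxne j hj.le
    have e2 := hxne (j + 1) hj
    have e3 : x (j + 1) * (x j * m j) - x j * (x (j + 1) * m (j + 1)) =
        x j * x (j + 1) * (m j - m (j + 1)) := by ring
    rw [e3, hmstep]
    field_simp
  have hpr : τ N / S * r = 2 := by rw [hr]; field_simp
  have hB : ∀ j < N, x j * (x (j + 1) * m (j + 1) - τ N / S) -
      x (j + 1) * (x j * m j - τ N / S) = 2 * F j := by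
    intro j hj
    have e : x (j + 1) - x j = r * (F j + G j) := by rw [← hstep]; simp only [hx]; ring
    linear_combination (τ N / S) * e - hA j hj + (F j + G j) * hpr
  refine ⟨τ N / S, x, fun j => x j * m j, ?_, hA, hB, ?_, hx0N⟩
  · refine ⟨h2, by positivity, (div_lt_one hSpos).2 (by linarith), ?_, hmN, ?_, hxne, ?_, ?_, ?_,
      ?_⟩
    · simp [hm, hx0]
    · intro j hj
      exact mul_lt_mul_of_pos_left (by linarith [hstep j, hF j hj, hG j hj]) hrpos
    · simp only [hx, h0]; nlinarith
    · simp only [hx]; nlinarith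
    · intro j hj; rw [hA j hj]; linarith [hG j hj]
    · intro j hj; rw [hB j hj]; linarith [hF j hj]
  · rw [hx0N]
    field_simp
    rw [hS]; ring

/-! ### Odd accordion graphs are area-universal -/

lemma triangleArea_rotate (p q r : ℝ × ℝ) : triangleArea q r p = triangleArea p q r := by
  unfold triangleArea cross
  congr 2
  simp only [Prod.fst_sub, Prod.snd_sub]
  ring

lemma continuous_triangleArea {V : Type*} (u v w : V) :
    Continuous fun D : V → ℝ × ℝ => triangleArea (D u) (D v) (D w) := by
  unfold triangleArea cross
  simp only [Prod.fst_sub, Prod.snd_sub]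
  fun_prop

/-- It suffices to realize the areas of one orientation of each inner face of the bipyramid. -/
lemma accordion_realizes {ℓ : ℕ} {A : (accordion ℓ).innerFaces → ℝ≥0}
    {B : Set (Fin 6 ⊕ Fin ℓ) → ℝ} (hB : ∀ f, B f.1 = A f) {D : Fin 6 ⊕ Fin ℓ → ℝ × ℝ}
    (hn : ∀ j < ℓ + 3, triangleArea (D (Sum.inl 5)) (D (rim ℓ j)) (D (rim ℓ (j + 1))) =
      B {Sum.inl 5, rim ℓ j, rim ℓ (j + 1)})
    (hs : ∀ j < ℓ + 3, triangleArea (D (Sum.inl 2)) (D (rim ℓ (j + 1))) (D (rim ℓ j)) =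
      B {Sum.inl 2, rim ℓ (j + 1), rim ℓ j})
    (hc : triangleArea (D (Sum.inl 5)) (D (rim ℓ (ℓ + 3))) (D (rim ℓ 0)) =
      B {Sum.inl 5, rim ℓ (ℓ + 3), rim ℓ 0}) : (accordion ℓ).Realizes A D := by
  intro a b c h
  rw [← hB]
  have rot : ∀ {a b c : Fin 6 ⊕ Fin ℓ}, triangleArea (D a) (D b) (D c) = B {a, b, c} →
      triangleArea (D b) (D c) (D a) = B {b, c, a} := by
    intro a b c h
    rw [triangleArea_rotate, h, Set.insert_comm a b, Set.pair_comm a c]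
  have cyc : ∀ u v w : Fin 6 ⊕ Fin ℓ, triangleArea (D u) (D v) (D w) = B {u, v, w} →
      CyclicEq (a, b, c) (u, v, w) → triangleArea (D a) (D b) (D c) = B {a, b, c} := by
    rintro u v w e (hc | hc | hc) <;> simp only [Prod.mk.injEq] at hc <;>
      obtain ⟨rfl, rfl, rfl⟩ := hc
    · exact e
    · exact rot e
    · exact rot (rot e)
  obtain ⟨t, ht, hct⟩ := accordion_face h.1
  rcases ht with ⟨j, hj, rfl⟩ | ⟨j, hj, rfl⟩ | rfl | rfl
  · exact cyc _ _ _ (hn j hj) hct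
  · exact cyc _ _ _ (hs j hj) hct
  · exact cyc _ _ _ hc hct
  · refine absurd ?_ h.2
    rw [accordion_outer]
    rcases hct with hc | hc | hc <;> simp only [Prod.mk.injEq] at hc <;>
      obtain ⟨rfl, rfl, rfl⟩ := hc <;> simp [CyclicEq]

/-- Arbitrarily small perturbations make the areas positive and generic: each genericity condition
excludes the roots of a monic quadratic polynomial in `ε`. -/
lemma exists_generic_perturbation (F G : ℕ → ℝ) (N : ℕ) {δ : ℝ} (hδ : 0 < δ) :
    ∃ ε, 0 < ε ∧ ε < δ ∧ ∀ j, j + 1 < N →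
      (F j + ε) * (G (j + 1) + (((j + 1 : ℕ) : ℝ) + 1) * ε) ≠
        (F (j + 1) + ε) * (G j + ((j : ℝ) + 1) * ε) := by
  let bad : ℕ → Polynomial ℝ := fun j => Polynomial.X ^ 2 +
    Polynomial.C (F j * ((j : ℝ) + 2) + G (j + 1) - F (j + 1) * ((j : ℝ) + 1) - G j) *
      Polynomial.X + Polynomial.C (F j * G (j + 1) - F (j + 1) * G j)
  have hbad : ∀ j, bad j ≠ 0 := fun j => by
    have : (bad j).Monic := by simp only [bad]; monicity!
    exact this.ne_zero
  have hfin : (⋃ j ∈ Finset.range N, {ε | (bad j).IsRoot ε}).Finite :=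
    Set.Finite.biUnion (Finset.finite_toSet _) fun j _ =>
      Polynomial.finite_setOfPred_isRoot (hbad j)
  obtain ⟨ε, ⟨h1, h2⟩, h3⟩ := ((Set.Ioo_infinite hδ).sdiff hfin).nonempty
  refine ⟨ε, h1, h2, fun j hj e => h3 ?_⟩
  simp only [Set.mem_iUnion]
  refine ⟨j, Finset.mem_range.2 (by omega), ?_⟩
  simp only [bad, Set.mem_ofPred_eq, Polynomial.IsRoot, Polynomial.eval_add, Polynomial.eval_pow,
    Polynomial.eval_X, Polynomial.eval_mul, Polynomial.eval_C]
  push_cast at e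
  linear_combination e

lemma exists_planarDrawing_areas {ℓ : ℕ} (hℓ : Odd ℓ) {F G : ℕ → ℝ} {a : ℝ} (ha : 0 < a)
    (hF : ∀ j < ℓ + 3, 0 < F j) (hG : ∀ j < ℓ + 3, 0 < G j)
    (hgen : ∀ j, j + 1 < ℓ + 3 → F j * G (j + 1) ≠ F (j + 1) * G j) {C : ℝ}
    (hC : 2 * (a + ∑ j ∈ Finset.range (ℓ + 3), (F j + G j)) ≤ C) :
    ∃ D ∈ (accordion ℓ).planarDrawings, (∀ v, D v ∈ Set.Icc (-C) C ×ˢ Set.Icc (0 : ℝ) 1) ∧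
      (∀ j < ℓ + 3, triangleArea (D (Sum.inl 5)) (D (rim ℓ j)) (D (rim ℓ (j + 1))) = F j) ∧
      (∀ j < ℓ + 3, triangleArea (D (Sum.inl 2)) (D (rim ℓ (j + 1))) (D (rim ℓ j)) = G j) ∧
      triangleArea (D (Sum.inl 5)) (D (rim ℓ (ℓ + 3))) (D (rim ℓ 0)) = a := by
  have heven : Even (ℓ + 3) := hℓ.add_odd (by decide)
  obtain ⟨p, x, h, R, hA, hB, hc, hx⟩ := exists_isRim heven (by omega) ha hF hG hgen
  have hx0 := R.x_zero_neg
  have hxN := R.x_last_pos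
  have area : ∀ {u v w : ℝ × ℝ} {t : ℝ}, 0 < t → cross (v - u) (w - u) = 2 * t →
      triangleArea u v w = t := by
    intro u v w t ht e
    rw [triangleArea, e, abs_of_pos (by linarith)]
    ring
  refine ⟨_, R.mem_planarDrawings, fun v => ?_, fun j hj => ?_, fun j hj => ?_, ?_⟩
  · rcases vertex_cases v with rfl | rfl | ⟨j, hj, rfl⟩
    · rw [rimDrawing_south]
      refine ⟨⟨?_, ?_⟩, ?_, ?_⟩ <;> dsimp only <;> linarith
    · rw [rimDrawing_north]
      have := R.p_pos
      have := R.p_lt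
      refine ⟨⟨?_, ?_⟩, ?_, ?_⟩ <;> dsimp only <;> linarith
    · rw [rimDrawing_rim hj]
      have := R.x_le_x (Nat.zero_le j) hj
      have := R.x_le_x hj le_rfl
      refine ⟨⟨?_, ?_⟩, (R.h_pos hj).le, R.h_le hj⟩ <;> dsimp only <;> linarith
  · rw [rimDrawing_north, rimDrawing_rim (by omega), rimDrawing_rim (by omega)]
    refine area (hF j hj) ?_
    rw [← hB j hj]; simp [cross]; ring
  · rw [rimDrawing_south, rimDrawing_rim (by omega), rimDrawing_rim (by omega)]
    refine area (hG j hj) ?_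
    rw [← hA j hj]; simp [cross]; ring
  · rw [rimDrawing_north, rimDrawing_rim (by omega), rimDrawing_rim (by omega)]
    refine area ha ?_
    rw [← hc]; simp [cross, R.h_zero, R.h_last]; ring

theorem isAreaUniversal_of_odd {ℓ : ℕ} (hℓ : Odd ℓ) : (accordion ℓ).IsAreaUniversal := by
  classical
  intro A
  let B : Set (Fin 6 ⊕ Fin ℓ) → ℝ := fun f =>
    if hf : f ∈ (accordion ℓ).innerFaces then A ⟨f, hf⟩ else 0
  have hBA : ∀ f, B f.1 = A f := fun f => by simp [B, f.2]
  have hB0 : ∀ f, 0 ≤ B f := fun f => by simp only [B]; split_ifs <;> simp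
  let F : ℕ → ℝ := fun j => B {Sum.inl 5, rim ℓ j, rim ℓ (j + 1)}
  let G : ℕ → ℝ := fun j => B {Sum.inl 2, rim ℓ (j + 1), rim ℓ j}
  let a : ℝ := B {Sum.inl 5, rim ℓ (ℓ + 3), rim ℓ 0}
  choose ε hε0 hε1 hgen using fun n : ℕ =>
    exists_generic_perturbation F G (ℓ + 3) (δ := 1 / ((n : ℝ) + 1)) (by positivity)
  have hεlt : ∀ n, ε n ≤ 1 := fun n => (hε1 n).le.trans (by
    rw [div_le_one (by positivity)]; linarith [n.cast_nonneg (α := ℝ)])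
  have hεlim : Filter.Tendsto ε Filter.atTop (nhds 0) :=
    squeeze_zero (fun n => (hε0 n).le) (fun n => (hε1 n).le) tendsto_one_div_add_atTop_nhds_zero_nat
  set C : ℝ := 2 * (a + 1 + ∑ j ∈ Finset.range (ℓ + 3), (F j + 1 + (G j + ((j : ℝ) + 1) * 1)))
    with hC
  have hbound : ∀ n, 2 * (a + ε n + ∑ j ∈ Finset.range (ℓ + 3),
      (F j + ε n + (G j + ((j : ℝ) + 1) * ε n))) ≤ C := by
    intro n
    rw [hC]
    have := hεlt n
    gcongr
  choose E hE hEK hEn hEs hEc using fun n : ℕ => exists_planarDrawing_areas hℓ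
    (F := fun j => F j + ε n) (G := fun j => G j + ((j : ℝ) + 1) * ε n) (a := a + ε n) (C := C)
    (by linarith [hB0 {Sum.inl 5, rim ℓ (ℓ + 3), rim ℓ 0}, hε0 n])
    (fun j _ => by linarith [hB0 {Sum.inl 5, rim ℓ j, rim ℓ (j + 1)}, hε0 n])
    (fun j _ => add_pos_of_nonneg_of_pos (hB0 _) (mul_pos (by positivity) (hε0 n)))
    (hgen n) (hbound n)
  have hcompact : IsCompact (Set.univ.pi fun _ : Fin 6 ⊕ Fin ℓ =>
      Set.Icc (-C) C ×ˢ Set.Icc (0 : ℝ) 1) :=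
    isCompact_univ_pi fun _ => isCompact_Icc.prod isCompact_Icc
  obtain ⟨D, -, φ, hφ, hD⟩ := hcompact.tendsto_subseq (x := E) fun n v _ => hEK n v
  have hεφ := hεlim.comp hφ.tendsto_atTop
  have lim : ∀ u v w (α κ : ℝ), (∀ n, triangleArea (E n u) (E n v) (E n w) = α + κ * ε n) →
      triangleArea (D u) (D v) (D w) = α := by
    intro u v w α κ h
    have h1 : Filter.Tendsto (fun n => triangleArea (E (φ n) u) (E (φ n) v) (E (φ n) w))
        Filter.atTop (nhds (triangleArea (D u) (D v) (D w))) :=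
      ((continuous_triangleArea u v w).tendsto D).comp hD
    have h2 : Filter.Tendsto (fun n => α + κ * ε (φ n)) Filter.atTop (nhds (α + κ * 0)) :=
      tendsto_const_nhds.add (tendsto_const_nhds.mul hεφ)
    simp only [h] at h1
    rw [mul_zero, add_zero] at h2
    exact tendsto_nhds_unique h1 h2
  have limN : ∀ j < ℓ + 3,
      triangleArea (D (Sum.inl 5)) (D (rim ℓ j)) (D (rim ℓ (j + 1))) = F j :=
    fun j hj => lim _ _ _ (F j) 1 fun n => by rw [hEn n j hj, one_mul]
  have limS : ∀ j < ℓ + 3,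
      triangleArea (D (Sum.inl 2)) (D (rim ℓ (j + 1))) (D (rim ℓ j)) = G j :=
    fun j hj => lim _ _ _ (G j) ((j : ℝ) + 1) fun n => by rw [hEs n j hj]
  have limC : triangleArea (D (Sum.inl 5)) (D (rim ℓ (ℓ + 3))) (D (rim ℓ 0)) = a :=
    lim _ _ _ a 1 fun n => by rw [hEc n, one_mul]
  exact ⟨D, ⟨fun n => E (φ n), fun n => hE (φ n), hD⟩, accordion_realizes hBA limN limS limC⟩

/-! ### Planar drawings orient all inner faces positively -/

section Orientation

variable {V : Type*} {T : TriangulationData V} {D : V → ℝ × ℝ}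

lemma cross_swap (u v : ℝ × ℝ) : cross v u = -cross u v := by
  unfold cross; ring

lemma cross_neg_smul (t : ℝ) (u v : ℝ × ℝ) : cross (-t • u) v = -(t * cross u v) := by
  simp [cross]; ring

/-- The Grassmann–Plücker relation in the plane. -/
lemma cross_pluecker (a b c d : ℝ × ℝ) :
    cross a b * cross c d + cross b c * cross a d + cross c a * cross b d = 0 := by
  unfold cross; ring

/-- No vertex of a planar drawing lies on an edge with other endpoints. -/
lemma notMem_segment (hD : T.IsPlanarDrawing D) {a b v c : V} (hab : T.graph.Adj a b)
    (hvc : T.graph.Adj v c) (hva : v ≠ a) (hvb : v ≠ b) :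
    D v ∉ segment ℝ (D a) (D b) := by
  intro hv
  have hne : s(a, b) ≠ s(v, c) := by
    intro e
    have : v ∈ s(a, b) := by rw [e]; exact Sym2.mem_mk_left v c
    rcases Sym2.mem_iff.1 this with h | h
    · exact hva h
    · exact hvb h
  obtain ⟨w, ⟨hw, -⟩, e⟩ := hD.2 a b v c hab hvc hne ⟨hv, left_mem_segment ℝ _ _⟩
  obtain rfl := hD.1 e
  rcases hw with h | h
  · exact hva h
  · exact hvb h

/-- In a planar drawing, two parallel edges at a vertex have opposite directions. -/
lemma opposite_of_cross_eq_zero (hD : T.IsPlanarDrawing D) {a b c : V} (hab : T.graph.Adj a b)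
    (hac : T.graph.Adj a c) (hbc : b ≠ c) (h : cross (D b - D a) (D c - D a) = 0) :
    ∃ t : ℝ, 0 < t ∧ D c - D a = -t • (D b - D a) := by
  set u := D b - D a with hu
  set v := D c - D a with hv
  have hu0 : u ≠ 0 := sub_ne_zero.2 fun e => hab.ne (hD.1 e).symm
  have hv0 : v ≠ 0 := sub_ne_zero.2 fun e => hac.ne (hD.1 e).symm
  have hn : 0 < u.1 * u.1 + u.2 * u.2 := by
    by_contra! hc
    apply hu0
    ext
    · simp only [Prod.fst_zero]; nlinarith [mul_self_nonneg u.1, mul_self_nonneg u.2]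
    · simp only [Prod.snd_zero]; nlinarith [mul_self_nonneg u.1, mul_self_nonneg u.2]
  set t := (u.1 * v.1 + u.2 * v.2) / (u.1 * u.1 + u.2 * u.2) with ht
  have hvt : v = t • u := by
    unfold cross at h
    ext
    · rw [Prod.smul_fst, smul_eq_mul, ht, div_mul_eq_mul_div, eq_div_iff hn.ne']
      linear_combination -u.2 * h
    · rw [Prod.smul_snd, smul_eq_mul, ht, div_mul_eq_mul_div, eq_div_iff hn.ne']
      linear_combination u.1 * h
  have hDb : D b = D a + u := by rw [hu]; abel
  have hDc : D c = D a + t • u := by rw [← hvt, hv]; abel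
  refine ⟨-t, ?_, by rw [neg_neg]; exact hvt⟩
  by_contra! htneg
  have ht0 : 0 < t := by
    refine lt_of_le_of_ne (by linarith) fun e => hv0 ?_
    rw [hvt, ← e, zero_smul]
  rcases le_total t 1 with ht1 | ht1
  · refine notMem_segment hD hab hac.symm hac.ne' hbc.symm ⟨1 - t, t, by linarith, ht0.le,
      by ring, ?_⟩
    rw [hDb, hDc]; module
  · refine notMem_segment hD hac hab.symm hab.ne' hbc ⟨1 - 1 / t, 1 / t, ?_, by positivity,
      by ring, ?_⟩
    · rw [sub_nonneg, div_le_one ht0]; exact ht1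
    · rw [hDb, hDc, smul_add, smul_smul, one_div, inv_mul_cancel₀ ht0.ne']; module

/-- A corner of a face is less than a half turn if both its edges lie to the right of another edge
at the same vertex. -/
lemma corner_pos (hD : T.IsPlanarDrawing D) (hR : T.HasRotation D) {a b c d : V}
    (hface : T.IsFace a b c) (hab : T.graph.Adj a b) (hac : T.graph.Adj a c)
    (had : T.graph.Adj a d) (hbc : b ≠ c) (hb : 0 < cross (D b - D a) (D d - D a))
    (hc : 0 < cross (D c - D a) (D d - D a)) : 0 < cross (D b - D a) (D c - D a) := by
  have h1 := hR a b c hface d had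
  refine lt_of_le_of_ne ?_ fun e => ?_
  · by_contra! hneg
    exact h1 (Or.inr (Or.inr ⟨by rw [cross_swap]; linarith, hb⟩))
  · obtain ⟨t, ht, e⟩ := opposite_of_cross_eq_zero hD hab hac hbc e.symm
    rw [e, cross_neg_smul] at hc
    linarith [mul_pos ht hb]

/-- If the corner from `b` to `p` at `w` is at least a half turn, then `z`, to the right of `b`,
also lies to the left of `p`. -/
lemma cross_pos_of_reflex_left (hD : T.IsPlanarDrawing D) (hR : T.HasRotation D) {w b p z : V}
    (hface : T.IsFace w b p) (hb : T.graph.Adj w b) (hp : T.graph.Adj w p)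
    (hz : T.graph.Adj w z) (hbp : b ≠ p) (hzp : z ≠ p)
    (hzb : 0 < cross (D z - D w) (D b - D w)) (hbad : cross (D b - D w) (D p - D w) ≤ 0) :
    0 < cross (D p - D w) (D z - D w) := by
  have h1 := hR w b p hface z hz
  rcases hbad.eq_or_lt with e | hbad
  · obtain ⟨t, ht, e⟩ := opposite_of_cross_eq_zero hD hb hp hbp e
    rw [e, cross_neg_smul, cross_swap (D z - D w)]
    linarith [mul_pos ht hzb]
  · have h2 : 0 < cross (D p - D w) (D b - D w) := by rw [cross_swap]; linarith
    refine lt_of_le_of_ne ?_ fun e => ?_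
    · by_contra! hneg
      exact h1 (Or.inr (Or.inl ⟨by rw [cross_swap]; linarith, h2⟩))
    · rw [cross_swap, zero_eq_neg] at e
      obtain ⟨t, ht, e⟩ := opposite_of_cross_eq_zero hD hz hp hzp e
      rw [e, cross_neg_smul] at h2
      linarith [mul_pos ht hzb]

/-- The mirror image of `cross_pos_of_reflex_left`. -/
lemma cross_pos_of_reflex_right (hD : T.IsPlanarDrawing D) (hR : T.HasRotation D) {w b p z : V}
    (hface : T.IsFace w p b) (hb : T.graph.Adj w b) (hp : T.graph.Adj w p)
    (hz : T.graph.Adj w z) (hbp : b ≠ p) (hzp : z ≠ p)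
    (hbz : 0 < cross (D b - D w) (D z - D w)) (hbad : cross (D p - D w) (D b - D w) ≤ 0) :
    0 < cross (D z - D w) (D p - D w) := by
  have h1 := hR w p b hface z hz
  rw [cross_swap] at hbz hbad ⊢
  rcases hbad.eq_or_lt with e | hbad
  · obtain ⟨t, ht, e⟩ := opposite_of_cross_eq_zero hD hb hp hbp (neg_eq_zero.1 e)
    rw [e, cross_neg_smul, cross_swap]
    linarith [mul_pos ht hbz]
  · have h2 : 0 < cross (D b - D w) (D p - D w) := by linarith
    refine lt_of_le_of_ne ?_ fun e => ?_
    · by_contra! hneg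
      exact h1 (Or.inr (Or.inr ⟨h2, by linarith⟩))
    · rw [zero_eq_neg, cross_swap, neg_eq_zero] at e
      obtain ⟨t, ht, e⟩ := opposite_of_cross_eq_zero hD hz hp hzp e
      rw [cross_swap, e, cross_neg_smul] at h2
      linarith [mul_pos ht hbz]

end Orientation

lemma mem_convexHull_triple {a b c z : ℝ × ℝ} (hz : z ∈ convexHull ℝ {a, b, c}) :
    ∃ α β γ : ℝ, 0 ≤ α ∧ 0 ≤ β ∧ 0 ≤ γ ∧ α + β + γ = 1 ∧ z = α • a + β • b + γ • c := by
  rw [← convexJoin_singleton_segment, mem_convexJoin] at hz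
  obtain ⟨x, hx, y, ⟨r, s, hr, hs, hrs, rfl⟩, ⟨t, u, ht, hu, htu, rfl⟩⟩ := hz
  rw [Set.mem_singleton_iff] at hx
  subst hx
  refine ⟨t, u * r, u * s, ht, mul_nonneg hu hr, mul_nonneg hu hs, ?_, ?_⟩
  · rw [add_assoc, ← mul_add, hrs, mul_one, htu]
  · rw [smul_add, smul_smul, smul_smul, add_assoc]

section AccordionOrientation

variable {ℓ : ℕ} {D : Fin 6 ⊕ Fin ℓ → ℝ × ℝ}

/-- The vertices off the outer triangle lie strictly inside it. -/
lemma interior_weights (hD : D ∈ (accordion ℓ).planarDrawings) {v u : Fin 6 ⊕ Fin ℓ}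
    (hvu : (accordion ℓ).graph.Adj v u) (h2 : v ≠ Sum.inl 2) (h0 : v ≠ rim ℓ 0)
    (hN : v ≠ rim ℓ (ℓ + 3)) :
    ∃ α β γ : ℝ, 0 < α ∧ 0 < β ∧ 0 < γ ∧ α + β + γ = 1 ∧
      D v = α • D (rim ℓ (ℓ + 3)) + β • D (Sum.inl 2) + γ • D (rim ℓ 0) := by
  obtain ⟨hP, -, hO⟩ := hD
  have hv := hO v
  rw [accordion_outer] at hv
  obtain ⟨α, β, γ, hα, hβ, hγ, hs, e⟩ := mem_convexHull_triple hv
  dsimp only at e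
  refine ⟨α, β, γ, lt_of_le_of_ne hα ?_, lt_of_le_of_ne hβ ?_, lt_of_le_of_ne hγ ?_, hs, e⟩
  · rintro rfl
    refine notMem_segment hP (adj_south (Nat.zero_le _)) hvu h2 h0
      ⟨β, γ, hβ, hγ, by linarith, ?_⟩
    rw [e, zero_smul, zero_add]
  · rintro rfl
    refine notMem_segment hP adj_closing hvu hN h0 ⟨α, γ, hα, hγ, by linarith, ?_⟩
    rw [e, zero_smul, add_zero]
  · rintro rfl
    refine notMem_segment hP (adj_south le_rfl).symm hvu hN h2 ⟨α, β, hα, hβ, by linarith, ?_⟩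
    rw [e, zero_smul, add_zero]

lemma outer_cross_pos (hD : D ∈ (accordion ℓ).planarDrawings) :
    0 < cross (D (rim ℓ (ℓ + 3)) - D (Sum.inl 2)) (D (rim ℓ 0) - D (Sum.inl 2)) := by
  have hne : rim ℓ (ℓ + 3) ≠ rim ℓ 0 := adj_closing.ne
  obtain ⟨α, β, γ, hα, hβ, hγ, hs, e⟩ := interior_weights hD (adj_rim (show 1 < ℓ + 3 by omega))
    (rim_ne_south (by omega)) (fun e => absurd (rim_injOn (by omega) (by omega) e) (by omega))
    (fun e => absurd (rim_injOn (by omega) le_rfl e) (by omega))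
  obtain ⟨hP, hR, -⟩ := hD
  rcases lt_trichotomy (cross (D (rim ℓ (ℓ + 3)) - D (Sum.inl 2)) (D (rim ℓ 0) - D (Sum.inl 2))) 0
    with hneg | hzero | hpos
  · exfalso
    refine hR _ _ _ face_outer (rim ℓ 1) (adj_south (by omega)) (Or.inl ⟨?_, ?_⟩)
    · have : cross (D (rim ℓ 0) - D (Sum.inl 2)) (D (rim ℓ 1) - D (Sum.inl 2)) =
          α * -cross (D (rim ℓ (ℓ + 3)) - D (Sum.inl 2)) (D (rim ℓ 0) - D (Sum.inl 2)) := by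
        obtain rfl : β = 1 - α - γ := by linarith
        rw [e]; simp [cross]; ring
      rw [this]; exact mul_pos hα (by linarith)
    · have : cross (D (rim ℓ 1) - D (Sum.inl 2)) (D (rim ℓ (ℓ + 3)) - D (Sum.inl 2)) =
          γ * -cross (D (rim ℓ (ℓ + 3)) - D (Sum.inl 2)) (D (rim ℓ 0) - D (Sum.inl 2)) := by
        obtain rfl : β = 1 - α - γ := by linarith
        rw [e]; simp [cross]; ring
      rw [this]; exact mul_pos hγ (by linarith)
  · -- three collinear points cannot each lie between the two others
    exfalso
    obtain ⟨s, hs, es⟩ := opposite_of_cross_eq_zero hP (adj_south le_rfl)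
      (adj_south (Nat.zero_le _)) hne hzero
    obtain ⟨t, ht, et⟩ := opposite_of_cross_eq_zero hP (adj_south (ℓ := ℓ) le_rfl).symm
      adj_closing (rim_ne_south (Nat.zero_le _)).symm (by
        rw [← neg_eq_zero, ← hzero]; simp [cross]; ring)
    have h0 : (s + 1 + t) • (D (rim ℓ (ℓ + 3)) - D (Sum.inl 2)) = 0 := by
      have : D (rim ℓ 0) - D (Sum.inl 2) - (D (rim ℓ 0) - D (rim ℓ (ℓ + 3))) =
        D (rim ℓ (ℓ + 3)) - D (Sum.inl 2) := by abel
      rw [es, et] at this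
      calc (s + 1 + t) • (D (rim ℓ (ℓ + 3)) - D (Sum.inl 2))
          = D (rim ℓ (ℓ + 3)) - D (Sum.inl 2) - (-s • (D (rim ℓ (ℓ + 3)) - D (Sum.inl 2)) -
              -t • (D (Sum.inl 2) - D (rim ℓ (ℓ + 3)))) := by module
        _ = 0 := by rw [this, sub_self]
    rcases smul_eq_zero.1 h0 with h | h
    · linarith
    · exact rim_ne_south le_rfl (hP.1 (sub_eq_zero.1 h))
  · exact hpos

/-- The three triangles that a vertex forms with the edges of the outer triangle are positively
oriented. -/
lemma interior_cross_pos (hD : D ∈ (accordion ℓ).planarDrawings) {v u : Fin 6 ⊕ Fin ℓ}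
    (hvu : (accordion ℓ).graph.Adj v u) (h2 : v ≠ Sum.inl 2) (h0 : v ≠ rim ℓ 0)
    (hN : v ≠ rim ℓ (ℓ + 3)) :
    0 < cross (D v - D (Sum.inl 2)) (D (rim ℓ 0) - D (Sum.inl 2)) ∧
      0 < cross (D v - D (rim ℓ 0)) (D (rim ℓ (ℓ + 3)) - D (rim ℓ 0)) ∧
      0 < cross (D v - D (rim ℓ (ℓ + 3))) (D (Sum.inl 2) - D (rim ℓ (ℓ + 3))) := by
  have hpos := outer_cross_pos hD
  obtain ⟨α, β, γ, hα, hβ, hγ, hs, e⟩ := interior_weights hD hvu h2 h0 hN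
  refine ⟨?_, ?_, ?_⟩
  · refine (mul_pos hα hpos).trans_eq ?_
    obtain rfl : β = 1 - α - γ := by linarith
    rw [e]; simp [cross]; ring
  · refine (mul_pos hβ hpos).trans_eq ?_
    obtain rfl : γ = 1 - α - β := by linarith
    rw [e]; simp [cross]; ring
  · refine (mul_pos hγ hpos).trans_eq ?_
    obtain rfl : α = 1 - β - γ := by linarith
    rw [e]; simp [cross]; ring

lemma rim_cross_pos (hD : D ∈ (accordion ℓ).planarDrawings) {j : ℕ} (h0 : 0 < j)
    (hj : j ≤ ℓ + 3) :
    0 < cross (D (rim ℓ j) - D (Sum.inl 2)) (D (rim ℓ 0) - D (Sum.inl 2)) := by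
  rcases hj.eq_or_lt with rfl | hN
  · exact outer_cross_pos hD
  · exact (interior_cross_pos hD (adj_rim hN) (rim_ne_south hj)
      (fun e => absurd (rim_injOn hj (by omega) e) (by omega))
      (fun e => absurd (rim_injOn hj le_rfl e) (by omega))).1

lemma planar_south_pos (hD : D ∈ (accordion ℓ).planarDrawings) {j : ℕ} (hj : j < ℓ + 3) :
    0 < cross (D (rim ℓ (j + 1)) - D (Sum.inl 2)) (D (rim ℓ j) - D (Sum.inl 2)) := by
  rcases Nat.eq_zero_or_pos j with rfl | h0
  · exact rim_cross_pos hD (by omega) hj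
  · exact corner_pos hD.1 hD.2.1 (face_south hj) (adj_south hj) (adj_south hj.le)
      (adj_south (Nat.zero_le _)) (adj_rim hj).ne' (rim_cross_pos hD (by omega) hj)
      (rim_cross_pos hD h0 hj.le)

lemma planar_north_closing_pos (hD : D ∈ (accordion ℓ).planarDrawings) :
    0 < cross (D (rim ℓ (ℓ + 3)) - D (Sum.inl 5)) (D (rim ℓ 0) - D (Sum.inl 5)) := by
  refine (interior_cross_pos hD (adj_north (Nat.zero_le _)) (by simp)
    (rim_ne_north (Nat.zero_le _)).symm (rim_ne_north le_rfl).symm).2.1.trans_eq ?_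
  simp [cross]; ring

lemma planar_north_pos (hD : D ∈ (accordion ℓ).planarDrawings) {j : ℕ} (hj : j < ℓ + 3) :
    0 < cross (D (rim ℓ j) - D (Sum.inl 5)) (D (rim ℓ (j + 1)) - D (Sum.inl 5)) := by
  have h5 := interior_cross_pos hD (adj_north (Nat.zero_le _)) (by simp)
    (rim_ne_north (Nat.zero_le _)).symm (rim_ne_north le_rfl).symm
  rcases Nat.eq_zero_or_pos j with rfl | h0
  · have h1 := interior_cross_pos hD (adj_rim (show 1 < ℓ + 3 by omega))
      (rim_ne_south (by omega)) (fun e => absurd (rim_injOn (by omega) (by omega) e) (by omega))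
      (fun e => absurd (rim_injOn (by omega) le_rfl e) (by omega))
    refine (corner_pos hD.1 hD.2.1 (face_rotate (face_north hj)) (adj_rim hj)
      (adj_north (Nat.zero_le _)).symm adj_closing.symm (rim_ne_north hj)
      h1.2.1 h5.2.1).trans_eq ?_
    simp [cross]; ring
  rcases (show j = ℓ + 2 ∨ j + 1 < ℓ + 3 by omega) with rfl | hj1
  · have h1 := interior_cross_pos hD (adj_rim hj)
      (rim_ne_south (by omega)) (fun e => absurd (rim_injOn (by omega) (by omega) e) (by omega))
      (fun e => absurd (rim_injOn (by omega) le_rfl e) (by omega))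
    refine (corner_pos hD.1 hD.2.1 (face_rotate (face_rotate (face_north hj)))
      (adj_north hj).symm (adj_rim hj).symm (adj_south hj).symm (rim_ne_north hj.le).symm
      h5.2.2 h1.2.2).trans_eq ?_
    simp [cross]; ring
  by_contra! hbad
  have hS := planar_south_pos hD hj
  have h1 := cross_pos_of_reflex_left hD.1 hD.2.1 (face_rotate (face_north hj)) (adj_rim hj)
    (adj_north hj.le).symm (adj_south hj.le).symm (rim_ne_north hj) (by simp)
    (hS.trans_eq (by simp [cross]; ring))
    (le_of_eq_of_le (by simp [cross]; ring) hbad)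
  have h2 := cross_pos_of_reflex_right hD.1 hD.2.1 (face_rotate (face_rotate (face_north hj)))
    (adj_rim hj).symm (adj_north hj).symm (adj_south hj).symm (rim_ne_north hj.le) (by simp)
    (hS.trans_eq (by simp [cross]; ring))
    (le_of_eq_of_le (by simp [cross]; ring) hbad)
  -- seen from the south apex, the three points would turn around it, although they all lie to the
  -- right of the first rim vertex
  have h1' : 0 < cross (D (rim ℓ j) - D (Sum.inl 2)) (D (Sum.inl 5) - D (Sum.inl 2)) :=
    h1.trans_eq (by simp [cross]; ring)
  have h2' : 0 < cross (D (Sum.inl 5) - D (Sum.inl 2)) (D (rim ℓ (j + 1)) - D (Sum.inl 2)) :=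
    h2.trans_eq (by simp [cross]; ring)
  have := cross_pluecker (D (rim ℓ j) - D (Sum.inl 2)) (D (Sum.inl 5) - D (Sum.inl 2))
    (D (rim ℓ (j + 1)) - D (Sum.inl 2)) (D (rim ℓ 0) - D (Sum.inl 2))
  linarith [mul_pos h1' (rim_cross_pos hD (Nat.succ_pos j) hj),
    mul_pos h2' (rim_cross_pos hD h0 hj.le), mul_pos hS h5.1]

lemma crossingFree_cross_nonneg (hD : D ∈ (accordion ℓ).crossingFreeDrawings)
    {u v w : Fin 6 ⊕ Fin ℓ}
    (h : ∀ E ∈ (accordion ℓ).planarDrawings, 0 < cross (E v - E u) (E w - E u)) :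
    0 ≤ cross (D v - D u) (D w - D u) := by
  obtain ⟨E, hE, hlim⟩ := hD
  have hc : Continuous fun D : Fin 6 ⊕ Fin ℓ → ℝ × ℝ => cross (D v - D u) (D w - D u) := by
    unfold cross
    simp only [Prod.fst_sub, Prod.snd_sub]
    fun_prop
  exact ge_of_tendsto' ((hc.tendsto D).comp hlim) fun n => (h (E n) (hE n)).le

end AccordionOrientation

/-! ### Even accordion graphs are not area-universal -/

/-- The equation that closes up the fans around the two apexes has no solution for alternating
areas `0, 1, 0, …` and an odd number of rim edges: the summands `1 / t (j + 1) - 1 / t j` are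
positive, except for the one where `t` changes its sign. -/
lemma alternating_balance_ne {t : ℕ → ℝ} {n : ℕ} (hstep : ∀ j < 2 * n + 1, t j - t (j + 1) = 2)
    (hne : ∀ j ≤ 2 * n + 1, t j ≠ 0) :
    1 / t (2 * n + 1) - 1 / t 0 ≠
      ∑ k ∈ Finset.range n, (1 / t (2 * k + 2) - 1 / t (2 * k + 1)) := by
  intro heq
  have hmono : ∀ i k, i < k → k ≤ 2 * n + 1 → t k < t i := fun i k hik hk => by
    have := lt_of_step (u := fun j => -t j) hik fun j _ h2 => by
      linarith [hstep j (by omega)]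
    linarith
  have hdiff : ∀ j < 2 * n + 1, 1 / t (j + 1) - 1 / t j = 2 / (t j * t (j + 1)) := by
    intro j hj
    have h1 := hne j hj.le
    have h2 := hne (j + 1) hj
    rw [← hstep j hj]
    field_simp
  have hdpos : ∀ j < 2 * n + 1, ¬ (0 < t j ∧ t (j + 1) < 0) → 0 < 1 / t (j + 1) - 1 / t j := by
    intro j hj hsign
    rw [hdiff j hj]
    apply div_pos two_pos
    have h1 := hmono j (j + 1) (by omega) hj
    rcases (hne j hj.le).lt_or_gt with h | h
    · exact mul_pos_of_neg_of_neg h (h1.trans h)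
    · rcases (hne (j + 1) hj).lt_or_gt with h' | h'
      · exact absurd ⟨h, h'⟩ hsign
      · exact mul_pos h h'
  by_cases hk : ∃ k ≤ n, 0 < t (2 * k) ∧ t (2 * k + 1) < 0
  · obtain ⟨k, hk, hpos, hneg⟩ := hk
    have h0 : 0 < t 0 := by
      rcases Nat.eq_zero_or_pos k with rfl | h
      · exact hpos
      · exact hpos.trans (hmono 0 (2 * k) (by omega) (by omega))
    have hN : t (2 * n + 1) < 0 := by
      rcases hk.eq_or_lt with rfl | h
      · exact hneg
      · exact (hmono (2 * k + 1) (2 * n + 1) (by omega) le_rfl).trans hneg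
    have hsum : 0 ≤ ∑ i ∈ Finset.range n, (1 / t (2 * i + 2) - 1 / t (2 * i + 1)) := by
      refine Finset.sum_nonneg fun i hi => (hdpos (2 * i + 1) ?_ ?_).le
      · have := Finset.mem_range.1 hi; omega
      · rintro ⟨h1, h2⟩
        have hi := Finset.mem_range.1 hi
        rcases lt_or_ge i k with h | h
        · rcases (show 2 * i + 2 ≤ 2 * k by omega).eq_or_lt with e | h'
          · have e : 2 * i + 1 + 1 = 2 * k := e
            rw [e] at h2; linarith
          · linarith [hmono (2 * i + 2) (2 * k) h' (by omega)]
        · rcases (show 2 * k + 1 ≤ 2 * i + 1 by omega).eq_or_lt with e | h'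
          · rw [← e] at h1; linarith
          · linarith [hmono (2 * k + 1) (2 * i + 1) h' (by omega)]
    have := one_div_pos.2 h0
    have := one_div_neg.2 hN
    linarith
  · push Not at hk
    have htel : ∀ m, (∑ k ∈ Finset.range m, (1 / t (2 * k + 2) - 1 / t (2 * k + 1))) +
        ∑ k ∈ Finset.range (m + 1), (1 / t (2 * k + 1) - 1 / t (2 * k)) =
        1 / t (2 * m + 1) - 1 / t 0 := by
      intro m
      induction m with
      | zero => simp
      | succ m ih =>
        rw [Finset.sum_range_succ, Finset.sum_range_succ _ (m + 1)]
        have e : 2 * (m + 1) = 2 * m + 2 := by ring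
        rw [e]
        linear_combination ih
    have hpos : 0 < ∑ k ∈ Finset.range (n + 1), (1 / t (2 * k + 1) - 1 / t (2 * k)) := by
      refine Finset.sum_pos (fun k hk' => ?_) ⟨0, by simp⟩
      have hk' := Finset.mem_range.1 hk'
      refine hdpos (2 * k) (by omega) fun h => ?_
      exact absurd h.2 (not_lt.2 (hk k (by omega) h.1))
    linarith [htel n]

/-- There are no points with the alternating signed areas. -/
lemma no_alternating_points {n : ℕ} (P : ℝ × ℝ) (W : ℕ → ℝ × ℝ)
    (hS : ∀ j < 2 * n + 1, cross (W (j + 1)) (W j) = if Odd j then 2 else 0)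
    (hN : ∀ j < 2 * n + 1, cross (W j - P) (W (j + 1) - P) = if Even j then 2 else 0)
    (hc : cross (W (2 * n + 1) - P) (W 0 - P) = 0) : False := by
  set t : ℕ → ℝ := fun j => cross P (W j) with ht
  have hexp : ∀ u v : ℝ × ℝ, cross (u - P) (v - P) = cross P u - cross P v - cross v u := by
    intro u v; simp [cross]; ring
  have hstep : ∀ j < 2 * n + 1, t j - t (j + 1) = 2 := by
    intro j hj
    have h1 := hN j hj
    rw [hexp, hS j hj] at h1
    simp only [ht]
    rcases Nat.even_or_odd j with h | h
    · rw [if_pos h, if_neg (Nat.not_odd_iff_even.2 h)] at h1; linarith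
    · rw [if_neg (Nat.not_even_iff_odd.2 h), if_pos h] at h1; linarith
  have hclose : cross (W (2 * n + 1)) (W 0) = t 0 - t (2 * n + 1) := by
    rw [hexp, cross_swap (W (2 * n + 1)) (W 0)] at hc
    simp only [ht]; linarith
  have hlt : t (2 * n + 1) < t 0 := by
    have := lt_of_step (u := fun j => -t j) (show 0 < 2 * n + 1 by omega) fun j _ h2 => by
      linarith [hstep j (by omega)]
    linarith
  have hP : ∀ j, cross (W j) P = -t j := fun j => cross_swap _ _
  have hne : ∀ j ≤ 2 * n + 1, t j ≠ 0 := by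
    intro j hj h0
    rcases Nat.eq_zero_or_pos j with rfl | hj0
    · have := cross_pluecker (W 1) (W 0) (W (2 * n + 1)) P
      rw [hS 0 (by omega), cross_swap (W (2 * n + 1)) (W 0), hclose, hP, hP, hP, h0] at this
      simp only [Nat.not_odd_zero, if_false] at this
      have := hstep 0 (by omega)
      nlinarith
    rcases hj.eq_or_lt with rfl | hjN
    · have := cross_pluecker (W (2 * n + 1)) (W (2 * n)) (W 0) P
      rw [hS (2 * n) (by omega), cross_swap (W (2 * n + 1)) (W 0), hclose, hP, hP, hP, h0,
        if_neg (Nat.not_odd_iff_even.2 (even_two_mul n))] at this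
      have := hstep (2 * n) (by omega)
      nlinarith
    · obtain ⟨i, rfl⟩ : ∃ i, j = i + 1 := ⟨j - 1, by omega⟩
      have := cross_pluecker (W (i + 2)) (W (i + 1)) (W i) P
      rw [hS (i + 1) hjN, hS i (by omega), hP, hP, hP, h0] at this
      have h1 := hstep i (by omega)
      have h2 : t (i + 1) - t (i + 2) = 2 := hstep (i + 1) hjN
      rcases Nat.even_or_odd i with h | h
      · rw [if_pos h.add_one, if_neg (Nat.not_odd_iff_even.2 h)] at this; linarith
      · rw [if_pos h, if_neg (Nat.not_odd_iff_even.2 h.add_one)] at this; linarith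
  have ht0 := hne 0 (by omega)
  -- seen from the south apex, the slopes of the rim vertices change only along odd rim edges
  have hslope : ∀ j < 2 * n + 1, cross (W (j + 1)) (W 0) / t (j + 1) - cross (W j) (W 0) / t j =
      (if Odd j then t 0 * (1 / t (j + 1) - 1 / t j) else 0) := by
    intro j hj
    have h1 := hne j hj.le
    have h2 := hne (j + 1) hj
    have := cross_pluecker (W (j + 1)) (W j) (W 0) P
    rw [hS j hj, cross_swap (W (j + 1)) (W 0), hP, hP, hP] at this
    have h3 := hstep j hj
    split_ifs at this ⊢
    · field_simp
      linear_combination this - t 0 * h3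
    · field_simp
      linear_combination this
  have hsum : ∀ k ≤ n, cross (W (2 * k + 1)) (W 0) / t (2 * k + 1) =
      t 0 * ∑ i ∈ Finset.range k, (1 / t (2 * i + 2) - 1 / t (2 * i + 1)) := by
    intro k hk
    induction k with
    | zero =>
      have := hS 0 (by omega)
      simp only [Nat.not_odd_zero, if_false] at this
      simp [this]
    | succ k ih =>
      have h1 := hslope (2 * k + 1) (by omega)
      have h2 := hslope (2 * k + 2) (by omega)
      rw [if_pos (odd_two_mul_add_one k)] at h1
      rw [if_neg (Nat.not_odd_iff_even.2 ⟨k + 1, by ring⟩)] at h2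
      rw [Finset.sum_range_succ, mul_add (t 0), ← ih (by omega)]
      have e : 2 * (k + 1) + 1 = 2 * k + 2 + 1 := by ring
      rw [e]
      have e' : 2 * k + 1 + 1 = 2 * k + 2 := rfl
      rw [e'] at h1
      linarith
  refine alternating_balance_ne hstep hne (mul_left_cancel₀ ht0 ?_)
  rw [← hsum n le_rfl, hclose]
  have := hne (2 * n + 1) le_rfl
  field_simp

/-- The areas `0` and `1`, alternating along the rim: `1` on the triangles of the odd rim edges with
the south apex and of the even rim edges with the north apex. -/
noncomputable def alternatingArea (ℓ : ℕ) (f : Set (Fin 6 ⊕ Fin ℓ)) : ℝ≥0 :=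
  open Classical in
  if ∃ j < ℓ + 3, rim ℓ j ∈ f ∧ rim ℓ (j + 1) ∈ f ∧
    (Sum.inl 2 ∈ f ∧ Odd j ∨ Sum.inl 5 ∈ f ∧ Even j) then 1 else 0

lemma alternatingArea_eq {ℓ : ℕ} {f : Set (Fin 6 ⊕ Fin ℓ)} {q : Prop} [Decidable q]
    (h : (∃ j < ℓ + 3, rim ℓ j ∈ f ∧ rim ℓ (j + 1) ∈ f ∧
      (Sum.inl 2 ∈ f ∧ Odd j ∨ Sum.inl 5 ∈ f ∧ Even j)) ↔ q) :
    alternatingArea ℓ f = if q then 1 else 0 := by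
  by_cases hq : q
  · rw [if_pos hq]; exact if_pos (h.2 hq)
  · rw [if_neg hq]; exact if_neg fun h' => hq (h.1 h')

lemma alternatingArea_south {ℓ j : ℕ} (hj : j < ℓ + 3) :
    alternatingArea ℓ {Sum.inl 2, rim ℓ (j + 1), rim ℓ j} = if Odd j then 1 else 0 := by
  refine alternatingArea_eq ⟨?_, fun h => ⟨j, hj, by simp [h]⟩⟩
  rintro ⟨i, hi, h1, h2, h3⟩
  simp only [Set.mem_insert_iff, Set.mem_singleton_iff, rim_ne_south hi.le,
    rim_ne_south (show i + 1 ≤ ℓ + 3 from hi), false_or, (rim_ne_north hj.le).symm,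
    (rim_ne_north (show j + 1 ≤ ℓ + 3 from hj)).symm, Sum.inl.injEq] at h1 h2 h3
  have e : i = j := by
    rcases h1 with h1 | h1
    · rcases h2 with h2 | h2 <;>
        have := rim_injOn (by omega) (by omega) h1 <;>
        have := rim_injOn (by omega) (by omega) h2 <;> omega
    · exact rim_injOn (by omega) (by omega) h1
  subst e
  simpa using h3

lemma alternatingArea_north {ℓ j : ℕ} (hj : j < ℓ + 3) :
    alternatingArea ℓ {Sum.inl 5, rim ℓ j, rim ℓ (j + 1)} = if Even j then 1 else 0 := by
  refine alternatingArea_eq ⟨?_, fun h => ⟨j, hj, by simp [h]⟩⟩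
  rintro ⟨i, hi, h1, h2, h3⟩
  simp only [Set.mem_insert_iff, Set.mem_singleton_iff, rim_ne_north hi.le,
    rim_ne_north (show i + 1 ≤ ℓ + 3 from hi), false_or, (rim_ne_south hj.le).symm,
    (rim_ne_south (show j + 1 ≤ ℓ + 3 from hj)).symm, Sum.inl.injEq] at h1 h2 h3
  have e : i = j := by
    rcases h1 with h1 | h1
    · exact rim_injOn (by omega) (by omega) h1
    · rcases h2 with h2 | h2 <;>
        have := rim_injOn (by omega) (by omega) h1 <;>
        have := rim_injOn (by omega) (by omega) h2 <;> omega
  subst e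
  simpa using h3

lemma alternatingArea_closing (ℓ : ℕ) :
    alternatingArea ℓ {Sum.inl 5, rim ℓ (ℓ + 3), rim ℓ 0} = 0 := by
  unfold alternatingArea
  refine if_neg ?_
  rintro ⟨i, hi, h1, h2, -⟩
  simp only [Set.mem_insert_iff, Set.mem_singleton_iff, rim_ne_north hi.le,
    rim_ne_north (show i + 1 ≤ ℓ + 3 from hi), false_or] at h1 h2
  rcases h1 with h1 | h1 <;> rcases h2 with h2 | h2 <;>
    have := rim_injOn (by omega) (by omega) h1 <;>
    have := rim_injOn (by omega) (by omega) h2 <;> omega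

theorem not_isAreaUniversal_of_even {ℓ : ℕ} (hℓ : Even ℓ) : ¬ (accordion ℓ).IsAreaUniversal := by
  intro hU
  obtain ⟨D, hD, hA⟩ := hU fun f => alternatingArea ℓ f.1
  have signed : ∀ {u v w : Fin 6 ⊕ Fin ℓ} {c : ℝ≥0}, (accordion ℓ).IsInnerFace u v w →
      alternatingArea ℓ {u, v, w} = c →
      (∀ E ∈ (accordion ℓ).planarDrawings, 0 < cross (E v - E u) (E w - E u)) →
      cross (D v - D u) (D w - D u) = 2 * c := by
    intro u v w c hf hc hpos
    have h1 := hA u v w hf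
    rw [triangleArea, abs_of_nonneg (crossingFree_cross_nonneg hD hpos)] at h1
    dsimp only at h1
    rw [hc] at h1
    linarith
  obtain ⟨k, hk⟩ := hℓ
  have hN : ℓ + 3 = 2 * (k + 1) + 1 := by omega
  refine no_alternating_points (n := k + 1) (D (Sum.inl 5) - D (Sum.inl 2))
    (fun j => D (rim ℓ j) - D (Sum.inl 2)) ?_ ?_ ?_
  · intro j hj
    rw [← hN] at hj
    rw [signed (innerFace_south hj) (alternatingArea_south hj) fun E hE => planar_south_pos hE hj]
    split_ifs <;> simp
  · intro j hj
    rw [← hN] at hj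
    rw [sub_sub_sub_cancel_right, sub_sub_sub_cancel_right,
      signed (innerFace_north hj) (alternatingArea_north hj) fun E hE => planar_north_pos hE hj]
    split_ifs <;> simp
  · rw [sub_sub_sub_cancel_right, sub_sub_sub_cancel_right, ← hN,
      signed innerFace_north_closing (alternatingArea_closing ℓ)
        fun E hE => planar_north_closing_pos hE]
    simp

theorem theorem3 (ℓ : ℕ) : (accordion ℓ).IsAreaUniversal ↔ Odd ℓ := by
  refine ⟨fun h => ?_, isAreaUniversal_of_odd⟩
  by_contra hodd
  exact not_isAreaUniversal_of_even (Nat.not_odd_iff_even.1 hodd) h
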